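/- Let $T>0$, $p>1$, $\alpha\in(1/p,1]$ and $f\in C([0,T]\times\mathbb R,\mathbb R)$, and put $F(t,x)=\int_0^x f(t,s)\,ds$. For $\gamma>0$ and $n\in\mathbb N$ with $n-1\le\gamma<n$ let $${}_0D_t^{\gamma}u(t)=\frac{d^n}{dt^n}\,\frac1{\Gamma(n-\gamma)}\int_0^t (t-s)^{n-\gamma-1}u(s)\,ds$$ be the left Riemann–Liouville fractional derivative. Let $E_0^{\alpha,p}$ be the closure of $C_0^\infty((0,T),\mathbb R)$ with respect to the norm $\|u\|=(\|u\|_{L^p}^p+\|{}_0D_t^\alpha u\|_{L^p}^p)^{1/p}$, where $L^p=L^p([0,T],\mathbb R)$, and let $$I(u)=\int_0^T\Bigl(\frac1p|{}_0D_t^\alpha u(t)|^p-F(t,u(t))\Bigr)dt,\qquad u\in E_0^{\alpha,p}.$$ A weak solution of the boundary value problem $${}_tD_T^\alpha\phi_p({}_0D_t^\alpha u(t))=f(t,u(t)),\quad t\in(0,T),\qquad u(0)=u(T)=0,$$ where $\phi_p(s)=|s|^{p-2}s$ for $s\neq0$, $\phi_p(0)=0$, and ${}_tD_T^\alpha$ is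 the right Riemann–Liouville fractional derivative, is a critical point of $I$, that is, a point $u\in E_0^{\alpha,p}$ at which $I$ is Fréchet differentiable with $I'(u)=0$. Assume: $(H_1)$ there are a constant $1<r_1<p$ and a nonnegative function $a\in L^1([0,T])$ such that $|f(t,x)|\le r_1a(t)|x|^{r_1-1}$ for all $(t,x)\in[0,T]\times\mathbb R$; $(H_2)$ there are a nonempty open interval $\mathbb I\subset[0,T]$ and constants $\eta,\delta>0$, $1<r_2<p$ such that $F(t,x)\ge\eta|x|^{r_2}$ for all $(t,x)\in\mathbb I\times[-\delta,\delta]$. Then the integrand of $I(u)$ is integrable on $[0,T]$ for every $u\in E_0^{\alpha,p}$, the functional $I$ is coercive ($I(u)\to\infty$ as $\|u\|\to\infty$), and the boundary value problem has at least one nontrivial weak solution. More precisely, there is a weak solution $u^*\in E_0^{\alpha,p}$ with $u^*\ne0$ that is a global minimizer of $I$ on $E_0^{\alpha,p}$ and satisfies $I(u^*)<0$. -/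

import Mathlib

open MeasureTheory Set Filter Topology
open scoped ENNReal ContDiff Convolution

noncomputable section

namespace FracDirichlet

/-- Left Riemann–Liouville fractional integral of order `γ` with base point `0`. -/
def leftRLInt (γ : ℝ) (u : ℝ → ℝ) (t : ℝ) : ℝ :=
  1 / Real.Gamma γ * ∫ s in (0 : ℝ)..t, (t - s) ^ (γ - 1) * u s

/-- Left Riemann–Liouville fractional derivative of order `γ ≥ 0` with base point `0`:
`dⁿ/dtⁿ` of the fractional integral of order `n - γ`, where `n - 1 ≤ γ < n`. In particular `n = 2`
for `γ = 1`, so that on `L^p` classes nothing depends on the choice of a representative. -/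
def leftRLDeriv (γ : ℝ) (u : ℝ → ℝ) : ℝ → ℝ :=
  iteratedDeriv (⌊γ⌋₊ + 1) (leftRLInt ((⌊γ⌋₊ + 1 : ℕ) - γ) u)

/-- The space of smooth functions with compact support in the open interval `(0, T)`. -/
def testFunctions (T : ℝ) : Submodule ℝ (ℝ → ℝ) where
  carrier := {φ | ContDiff ℝ ∞ φ ∧ HasCompactSupport φ ∧ tsupport φ ⊆ Ioo 0 T}
  add_mem' := by
    rintro φ ψ ⟨h1, h2, h3⟩ ⟨k1, k2, k3⟩
    exact ⟨h1.add k1, h2.add k2, (tsupport_add φ ψ).trans (union_subset h3 k3)⟩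
  zero_mem' := by
    refine ⟨contDiff_const, HasCompactSupport.zero, ?_⟩
    have h0 : tsupport (0 : ℝ → ℝ) = ∅ := by simp [tsupport]
    rw [h0]
    exact empty_subset _
  smul_mem' := by
    rintro c φ ⟨h1, h2, h3⟩
    exact ⟨contDiff_const.smul h1, h2.smul_left (f := fun _ => c),
      (closure_mono (Function.support_const_smul_subset c φ)).trans h3⟩

/-- The kernel of the fractional integral. -/
def kernelRL (γ : ℝ) : ℝ → ℝ := (Ioi (0 : ℝ)).indicator fun s => s ^ (γ - 1)

lemma locallyIntegrable_kernelRL {γ : ℝ} (hγ : 0 < γ) : LocallyIntegrable (kernelRL γ) := by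
  rw [locallyIntegrable_iff]
  intro K hK
  obtain ⟨R, hR⟩ := hK.isBounded.subset_closedBall 0
  have h : IntegrableOn (kernelRL γ) (Icc (-|R|) |R|) := by
    unfold kernelRL
    rw [IntegrableOn, integrable_indicator_iff measurableSet_Ioi, IntegrableOn,
      Measure.restrict_restrict measurableSet_Ioi]
    have h1 : IntervalIntegrable (fun s : ℝ => s ^ (γ - 1)) volume 0 |R| :=
      intervalIntegral.intervalIntegrable_rpow' (by linarith)
    rw [intervalIntegrable_iff_integrableOn_Ioc_of_le (abs_nonneg R)] at h1
    exact h1.mono_set fun x hx => ⟨hx.1, hx.2.2⟩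
  refine h.mono_set fun x hx => ?_
  have := hR hx
  rw [Metric.mem_closedBall, dist_zero_right, Real.norm_eq_abs] at this
  exact abs_le.1 (this.trans (le_abs_self R))

lemma testFunctions_eq_zero {T : ℝ} {φ : ℝ → ℝ} (hφ : φ ∈ testFunctions T) {s : ℝ}
    (hs : s ≤ 0) : φ s = 0 := by
  by_contra h
  exact absurd (hφ.2.2 (subset_tsupport φ h)).1 (not_lt.2 hs)

lemma leftRLInt_eq_convolution {T γ : ℝ} {φ : ℝ → ℝ} (hφ : φ ∈ testFunctions T) :
    leftRLInt γ φ = fun t => 1 / Real.Gamma γ *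
      (kernelRL γ ⋆[ContinuousLinearMap.mul ℝ ℝ, volume] φ) t := by
  funext t
  unfold leftRLInt
  congr 1
  have h2 : (kernelRL γ ⋆[ContinuousLinearMap.mul ℝ ℝ, volume] φ) t
      = ∫ s, kernelRL γ (t - s) * φ s := by
    rw [convolution_eq_swap]
    rfl
  rw [h2]
  rcases le_total 0 t with ht | ht
  · rw [intervalIntegral.integral_of_le ht, integral_Ioc_eq_integral_Ioo,
      ← integral_indicator measurableSet_Ioo]
    congr 1
    funext s
    by_cases hs : s ∈ Ioo 0 t
    · have : t - s ∈ Ioi (0 : ℝ) := by simpa using hs.2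
      simp [kernelRL, hs, indicator_of_mem this]
    · rw [indicator_of_notMem hs]
      rcases le_or_gt s 0 with h0 | h0
      · simp [testFunctions_eq_zero hφ h0]
      · have : t - s ∉ Ioi (0 : ℝ) := by
          intro h
          exact hs ⟨h0, by simpa using h⟩
        simp [kernelRL, indicator_of_notMem this]
  · rw [intervalIntegral.integral_of_ge ht]
    have h3 : ∀ s, kernelRL γ (t - s) * φ s = 0 := by
      intro s
      rcases le_or_gt s 0 with h0 | h0
      · simp [testFunctions_eq_zero hφ h0]
      · have : t - s ∉ Ioi (0 : ℝ) := by
          simp only [mem_Ioi, not_lt]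
          linarith
        simp [kernelRL, indicator_of_notMem this]
    have h4 : ∫ s in Ioc t 0, (t - s) ^ (γ - 1) * φ s = 0 := by
      refine setIntegral_eq_zero_of_forall_eq_zero fun s hs => ?_
      simp [testFunctions_eq_zero hφ hs.2]
    simp [h3, h4]

lemma contDiff_leftRLInt {T γ : ℝ} (hγ : 0 < γ) {φ : ℝ → ℝ} (hφ : φ ∈ testFunctions T) :
    ContDiff ℝ ∞ (leftRLInt γ φ) := by
  rw [leftRLInt_eq_convolution hφ]
  exact contDiff_const.mul
    (hφ.2.1.contDiff_convolution_right _ (locallyIntegrable_kernelRL hγ) hφ.1)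

lemma order_pos (α : ℝ) : 0 < ((⌊α⌋₊ + 1 : ℕ) : ℝ) - α := by
  have := Nat.lt_floor_add_one α
  push_cast
  linarith

lemma continuous_leftRLDeriv {T : ℝ} (α : ℝ) {φ : ℝ → ℝ} (hφ : φ ∈ testFunctions T) :
    Continuous (leftRLDeriv α φ) :=
  (contDiff_leftRLInt (order_pos α) hφ).continuous_iteratedDeriv _
    (by exact_mod_cast le_top)

lemma leftRLInt_add {T γ : ℝ} (hγ : 0 < γ) {φ ψ : ℝ → ℝ} (hφ : φ ∈ testFunctions T)
    (hψ : ψ ∈ testFunctions T) :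
    leftRLInt γ (φ + ψ) = leftRLInt γ φ + leftRLInt γ ψ := by
  rw [leftRLInt_eq_convolution hφ, leftRLInt_eq_convolution hψ,
    leftRLInt_eq_convolution (add_mem hφ hψ)]
  have h1 : ConvolutionExists (kernelRL γ) φ (ContinuousLinearMap.mul ℝ ℝ) volume :=
    hφ.2.1.convolutionExists_right _ (locallyIntegrable_kernelRL hγ) hφ.1.continuous
  have h2 : ConvolutionExists (kernelRL γ) ψ (ContinuousLinearMap.mul ℝ ℝ) volume :=
    hψ.2.1.convolutionExists_right _ (locallyIntegrable_kernelRL hγ) hψ.1.continuous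
  rw [h1.distrib_add h2]
  funext t
  simp [mul_add]

lemma leftRLInt_smul (γ c : ℝ) (φ : ℝ → ℝ) :
    leftRLInt γ (c • φ) = c • leftRLInt γ φ := by
  funext t
  have : ∀ s, (t - s) ^ (γ - 1) * (c * φ s) = c * ((t - s) ^ (γ - 1) * φ s) := by
    intro s
    ring
  simp only [leftRLInt, Pi.smul_apply, smul_eq_mul, this, intervalIntegral.integral_const_mul]
  ring

lemma leftRLDeriv_add {T : ℝ} (α : ℝ) {φ ψ : ℝ → ℝ} (hφ : φ ∈ testFunctions T)
    (hψ : ψ ∈ testFunctions T) :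
    leftRLDeriv α (φ + ψ) = leftRLDeriv α φ + leftRLDeriv α ψ := by
  unfold leftRLDeriv
  rw [leftRLInt_add (order_pos α) hφ hψ]
  funext t
  exact iteratedDeriv_add
    ((contDiff_leftRLInt (order_pos α) hφ).contDiffAt.of_le (by exact_mod_cast le_top))
    ((contDiff_leftRLInt (order_pos α) hψ).contDiffAt.of_le (by exact_mod_cast le_top))

lemma leftRLDeriv_smul {T : ℝ} (α c : ℝ) {φ : ℝ → ℝ} (hφ : φ ∈ testFunctions T) :
    leftRLDeriv α (c • φ) = c • leftRLDeriv α φ := by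
  unfold leftRLDeriv
  rw [leftRLInt_smul]
  funext t
  exact iteratedDeriv_const_smul
    ((contDiff_leftRLInt (order_pos α) hφ).contDiffAt.of_le (by exact_mod_cast le_top)) c

lemma memLp_of_continuous (q : ℝ≥0∞) (T : ℝ) {g : ℝ → ℝ} (hg : Continuous g) :
    MemLp g q (volume.restrict (Icc 0 T)) := by
  obtain ⟨C, hC⟩ := (isCompact_Icc (a := (0 : ℝ)) (b := T)).exists_bound_of_continuousOn
    hg.continuousOn
  exact MemLp.of_bound hg.aestronglyMeasurable C
    ((ae_restrict_iff' measurableSet_Icc).2 (Eventually.of_forall hC))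

instance factOneLe (p : ℝ) [hp : Fact (1 < p)] : Fact (1 ≤ ENNReal.ofReal p) :=
  ⟨ENNReal.one_le_ofReal.2 hp.out.le⟩

/-- `L^p([0, T], ℝ)`. -/
abbrev LpT (p T : ℝ) := Lp ℝ (ENNReal.ofReal p) (volume.restrict (Icc (0 : ℝ) T))

/-- Pairs `(u, w)` in `L^p([0, T]) × L^p([0, T])` with the norm
`(‖u‖_{L^p}^p + ‖w‖_{L^p}^p)^{1/p}`. -/
abbrev LpPair (p T : ℝ) := WithLp (ENNReal.ofReal p) (LpT p T × LpT p T)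

/-- The map `φ ↦ (φ, ₀D_t^α φ)`, through which the norm `‖φ‖_{E^{α,p}}` on test functions is the
norm of `LpPair p T`. -/
def graphMap (α p T : ℝ) : testFunctions T →ₗ[ℝ] LpPair p T where
  toFun φ := WithLp.toLp _
    ((memLp_of_continuous (ENNReal.ofReal p) T φ.2.1.continuous).toLp φ.1,
      (memLp_of_continuous (ENNReal.ofReal p) T (continuous_leftRLDeriv α φ.2)).toLp
        (leftRLDeriv α φ.1))
  map_add' φ ψ := by
    simp only [Submodule.coe_add, leftRLDeriv_add α φ.2 ψ.2]
    rfl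
  map_smul' c φ := by
    simp only [Submodule.coe_smul, leftRLDeriv_smul α c φ.2]
    rfl

/-- The fractional derivative space `E_0^{α,p}`: the closure of the test functions for the norm
`(‖u‖_{L^p}^p + ‖₀D_t^α u‖_{L^p}^p)^{1/p}`, realized as the closure in `L^p × L^p` of the set of
the pairs `(φ, ₀D_t^α φ)`. The underlying function of an element is its first component. -/
abbrev FracSpace (α p T : ℝ) [Fact (1 < p)] : Submodule ℝ (LpPair p T) :=
  (LinearMap.range (graphMap α p T)).topologicalClosure

/-- The function `u : [0, T] → ℝ` (a class in `L^p`) underlying an element of `E_0^{α,p}`. -/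
def toLpT {α p T : ℝ} [Fact (1 < p)] (u : FracSpace α p T) : LpT p T := (u : LpPair p T).fst

/-- `F(t, x) = ∫₀ˣ f(t, s) ds`. -/
def primitive (f : ℝ → ℝ → ℝ) (t x : ℝ) : ℝ := ∫ s in (0 : ℝ)..x, f t s

/-- The integrand `|₀D_t^α u(t)|^p / p - F(t, u(t))` of the energy. -/
def energyDensity {α p T : ℝ} [Fact (1 < p)] (f : ℝ → ℝ → ℝ) (u : FracSpace α p T) (t : ℝ) : ℝ :=
  1 / p * |leftRLDeriv α (toLpT u) t| ^ p - primitive f t (toLpT u t)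

/-- The energy functional `I` on `E_0^{α,p}`. -/
def energy {α p T : ℝ} [Fact (1 < p)] (f : ℝ → ℝ → ℝ) (u : FracSpace α p T) : ℝ :=
  ∫ t in Icc (0 : ℝ) T, energyDensity f u t

/-- Weak solutions of `_tD_T^α φ_p(₀D_t^α u) = f(t, u)` on `(0, T)`, `u(0) = u(T) = 0`: the
critical points of the energy functional on `E_0^{α,p}`, i.e. the points at which its Fréchet
derivative exists and vanishes. -/
def IsWeakSolution {α p T : ℝ} [Fact (1 < p)] (f : ℝ → ℝ → ℝ) (u : FracSpace α p T) : Prop :=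
  HasFDerivAt (energy f) (0 : FracSpace α p T →L[ℝ] ℝ) u

end FracDirichlet

end

/-!
Write `I^α` for the fractional integral of order `α` and let `q` be the exponent conjugate to `p`.
Since `α > 1 / p`, the kernel `s^(α - 1)` is `q`-integrable near the origin, and as translations are
continuous in `L^q`, Hölder's inequality and the Arzelà–Ascoli theorem make `I^α` a compact
operator from `L^p([0, T])` to the continuous functions (`fracInt`,
`exists_isCompact_fracInt_image`). Test functions satisfy `φ = I^α (₀D_t^α φ)`, because the kernels
of orders `α` and `1 - α` convolve to a multiple of the Heaviside function
(`testFunctions_eq_integral_leftRLDeriv`). Passing to the closure, every element of `E_0^{α,p}` is a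
pair `(I^α w, w)` (`potential_snd_eq`), and by Lebesgue's differentiation theorem the pointwise
Riemann–Liouville derivative of its first component is `w` almost everywhere
(`leftRLDeriv_toLpT_ae_eq`). So `E_0^{α,p}` embeds compactly into the continuous functions, its norm
is equivalent to `‖w‖_p`, and the energy is `‖w‖_p^p / p - ∫ F(t, I^α w)`.

The growth condition on `f` gives the lower bound `‖w‖_p^p / p - B ‖w‖_p^{r₁}` with `r₁ < p`
(`exists_le_energy`), hence coercivity. A minimizer is found without weak compactness
(`exists_forall_energy_le`): along a subsequence of a minimizing sequence the functions converge
uniformly, so `‖w‖_p^p` converges, and the midpoints, whose energy is not below the infimum, have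
asymptotically the same norm; uniform convexity of `L^p` (`exists_norm_sub_rpow_le`) then makes the
sequence of the `w` strongly Cauchy. The energy is Fréchet differentiable everywhere
(`differentiable_energy`), so its derivative vanishes at the minimizer. Finally the energy takes
negative values (`exists_energy_neg`), since `F(t, x) ≥ η |x|^{r₂}` with `r₂ < p` near `x = 0` on an
interval; this forces the minimizer to be nonzero.
-/

noncomputable section

namespace FracDirichlet

/-! ### Kernels of complementary fractional integrals -/

lemma measurable_kernelRL (γ : ℝ) : Measurable (kernelRL γ) :=
  (measurable_id.pow_const _).indicator measurableSet_Ioi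

lemma kernelRL_nonneg (γ x : ℝ) : 0 ≤ kernelRL γ x :=
  indicator_nonneg (fun _ hs => Real.rpow_nonneg (le_of_lt hs) _) x

lemma kernelRL_of_nonpos (γ : ℝ) {x : ℝ} (hx : x ≤ 0) : kernelRL γ x = 0 :=
  indicator_of_notMem (by simpa using hx) _

lemma kernelRL_of_pos (γ : ℝ) {x : ℝ} (hx : 0 < x) : kernelRL γ x = x ^ (γ - 1) :=
  indicator_of_mem (s := Ioi (0 : ℝ)) hx _

lemma integral_rpow_mul_rpow_eq_Gamma {a : ℝ} (ha : a ∈ Ioo (0 : ℝ) 1) {x : ℝ} (hx : 0 < x) :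
    ∫ r in (0 : ℝ)..x, r ^ ((1 - a) - 1) * (x - r) ^ (a - 1)
      = Real.Gamma a * Real.Gamma (1 - a) := by
  have h1 := Complex.betaIntegral_scaled ((1 - a : ℝ) : ℂ) (a : ℂ) hx
  have h2 := Complex.Gamma_mul_Gamma_eq_betaIntegral (s := ((1 - a : ℝ) : ℂ)) (t := (a : ℂ))
    (by rw [Complex.ofReal_re]; linarith [ha.2]) (by simpa using ha.1)
  have h3 : ((1 - a : ℝ) : ℂ) + a = 1 := by push_cast; ring
  rw [h3, Complex.Gamma_one, one_mul] at h2
  rw [h3, sub_self, Complex.cpow_zero, one_mul, ← h2, Complex.Gamma_ofReal,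
    Complex.Gamma_ofReal] at h1
  have h4 : ∫ r in (0 : ℝ)..x, (r : ℂ) ^ (((1 - a : ℝ) : ℂ) - 1) * ((x : ℂ) - r) ^ ((a : ℂ) - 1)
      = ((∫ r in (0 : ℝ)..x, r ^ ((1 - a) - 1) * (x - r) ^ (a - 1) : ℝ) : ℂ) := by
    rw [← intervalIntegral.integral_ofReal]
    refine intervalIntegral.integral_congr fun r hr => ?_
    rw [uIcc_of_le hx.le] at hr
    have e1 := Complex.ofReal_cpow hr.1 ((1 - a) - 1)
    have e2 := Complex.ofReal_cpow (sub_nonneg.2 hr.2) (a - 1)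
    push_cast at e1 e2 ⊢
    rw [e1, e2]
  rw [h4] at h1
  rw [mul_comm (Real.Gamma a)]
  exact_mod_cast h1

lemma Gamma_mul_Gamma_pos {a : ℝ} (ha : a ∈ Ioo (0 : ℝ) 1) :
    0 < Real.Gamma a * Real.Gamma (1 - a) :=
  mul_pos (Real.Gamma_pos_of_pos ha.1) (Real.Gamma_pos_of_pos (by linarith [ha.2]))

/-- Complementary kernels convolve to a multiple of the Heaviside function: this is the value
`B(a, 1 - a) = Γ(a) Γ(1 - a)` of the Beta function. -/
lemma integral_kernelRL_mul_kernelRL {a : ℝ} (ha : a ∈ Ioo (0 : ℝ) 1) (t s : ℝ) :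
    ∫ r, kernelRL a (t - r) * kernelRL (1 - a) (r - s)
      = (Iio t).indicator (fun _ => Real.Gamma a * Real.Gamma (1 - a)) s := by
  rw [← integral_add_right_eq_self _ s]
  simp only [add_sub_cancel_right]
  by_cases hs : s < t
  · rw [indicator_of_mem (by simpa using hs), ← integral_rpow_mul_rpow_eq_Gamma ha (sub_pos.2 hs),
      intervalIntegral.integral_of_le (sub_pos.2 hs).le, integral_Ioc_eq_integral_Ioo,
      ← integral_indicator measurableSet_Ioo]
    congr 1
    funext r
    by_cases hr : r ∈ Ioo 0 (t - s)
    · rw [indicator_of_mem hr, kernelRL_of_pos _ (by linarith [hr.2]), kernelRL_of_pos _ hr.1,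
        mul_comm]
      congr 2
      ring
    · rw [indicator_of_notMem hr]
      rcases le_or_gt r 0 with h0 | h0
      · rw [kernelRL_of_nonpos _ h0, mul_zero]
      · rw [kernelRL_of_nonpos _ (x := t - (r + s)) (by
          by_contra h
          exact hr ⟨h0, by linarith⟩), zero_mul]
  · rw [indicator_of_notMem (by simpa using hs)]
    refine integral_eq_zero_of_ae (Eventually.of_forall fun r => ?_)
    rcases le_or_gt r 0 with h0 | h0
    · simp [kernelRL_of_nonpos _ h0]
    · simp [kernelRL_of_nonpos a (x := t - (r + s)) (by linarith)]

/-- The composition of the fractional integrals of orders `1 - a` and `a` is, up to the constant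
`Γ(a) Γ(1 - a)`, integration. -/
lemma integral_kernelRL_integral_kernelRL {a : ℝ} (ha : a ∈ Ioo (0 : ℝ) 1) {g : ℝ → ℝ}
    (hg : Integrable g) (t : ℝ) :
    ∫ r, kernelRL a (t - r) * ∫ s, kernelRL (1 - a) (r - s) * g s
      = Real.Gamma a * Real.Gamma (1 - a) * ∫ s in Iio t, g s := by
  have hB := Gamma_mul_Gamma_pos ha
  have hint : Integrable (Function.uncurry fun r s =>
      kernelRL a (t - r) * (kernelRL (1 - a) (r - s) * g s)) (volume.prod volume) := by
    have hm : AEStronglyMeasurable (Function.uncurry fun r s =>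
        kernelRL a (t - r) * (kernelRL (1 - a) (r - s) * g s)) (volume.prod volume) := by
      refine AEStronglyMeasurable.mul ?_ (AEStronglyMeasurable.mul ?_ ?_)
      · exact ((measurable_kernelRL a).comp
          (measurable_const.sub measurable_fst)).aestronglyMeasurable
      · exact ((measurable_kernelRL (1 - a)).comp
          (measurable_fst.sub measurable_snd)).aestronglyMeasurable
      · exact hg.1.comp_snd
    -- Tonelli's theorem: the inner integral over `r` of the kernels is the Beta integral.
    rw [integrable_prod_iff' hm]
    refine ⟨Eventually.of_forall fun s => ?_, ?_⟩
    · by_cases hs : s < t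
      · have : Integrable fun r => kernelRL a (t - r) * kernelRL (1 - a) (r - s) := by
          refine Integrable.of_integral_ne_zero ?_
          rw [integral_kernelRL_mul_kernelRL ha, indicator_of_mem (by simpa using hs)]
          exact hB.ne'
        simpa [Function.uncurry, mul_assoc] using this.mul_const (g s)
      · refine (integrable_zero ℝ ℝ volume).congr (Eventually.of_forall fun r => ?_)
        rcases le_or_gt r s with h0 | h0
        · simp [Function.uncurry, kernelRL_of_nonpos (1 - a) (x := r - s) (by linarith)]
        · simp [Function.uncurry, kernelRL_of_nonpos a (x := t - r) (by linarith)]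
    · have : (fun s => ∫ r, ‖Function.uncurry (fun r s =>
          kernelRL a (t - r) * (kernelRL (1 - a) (r - s) * g s)) (r, s)‖)
          = (Iio t).indicator fun s => Real.Gamma a * Real.Gamma (1 - a) * ‖g s‖ := by
        funext s
        have : ∀ r, ‖Function.uncurry (fun r s =>
          kernelRL a (t - r) * (kernelRL (1 - a) (r - s) * g s)) (r, s)‖
          = (kernelRL a (t - r) * kernelRL (1 - a) (r - s)) * ‖g s‖ := by
          intro r
          simp only [Function.uncurry, norm_mul, Real.norm_of_nonneg (kernelRL_nonneg _ _),
            mul_assoc]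
        simp only [this, integral_mul_const, integral_kernelRL_mul_kernelRL ha]
        by_cases hs : s ∈ Iio t <;> simp [hs]
      rw [this]
      exact (hg.norm.const_mul _).indicator measurableSet_Iio
  simp only [← integral_const_mul]
  rw [integral_integral_swap hint, ← integral_indicator measurableSet_Iio]
  congr 1
  funext s
  simp only [← mul_assoc, integral_mul_const, integral_kernelRL_mul_kernelRL ha]
  by_cases hs : s ∈ Iio t <;> simp [hs]

lemma leftRLInt_eq_integral {γ t : ℝ} (ht : 0 ≤ t) (u : ℝ → ℝ) :
    leftRLInt γ u t
      = 1 / Real.Gamma γ * ∫ s, kernelRL γ (t - s) * (Ioi (0 : ℝ)).indicator u s := by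
  unfold leftRLInt
  rw [intervalIntegral.integral_of_le ht, integral_Ioc_eq_integral_Ioo,
    ← integral_indicator measurableSet_Ioo]
  congr 2
  funext s
  rcases le_or_gt s 0 with h0 | h0
  · simp [not_lt.2 h0]
  · rcases le_or_gt t s with h1 | h1
    · rw [kernelRL_of_nonpos _ (by linarith), indicator_of_notMem (by simp [h1]), zero_mul]
    · rw [kernelRL_of_pos _ (by linarith), indicator_of_mem (by simp [h0, h1]),
        indicator_of_mem (by simpa using h0)]

/-! ### Test functions are fractional integrals of their fractional derivatives -/

lemma convolution_kernelRL_apply (γ : ℝ) (φ : ℝ → ℝ) (t : ℝ) :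
    (kernelRL γ ⋆[ContinuousLinearMap.mul ℝ ℝ, volume] φ) t
      = ∫ s, kernelRL γ (t - s) * φ s := by
  rw [convolution_eq_swap]
  rfl

lemma deriv_convolution_kernelRL {T γ : ℝ} (hγ : 0 < γ) {φ : ℝ → ℝ} (hφ : φ ∈ testFunctions T) :
    deriv (kernelRL γ ⋆[ContinuousLinearMap.mul ℝ ℝ, volume] φ)
      = kernelRL γ ⋆[ContinuousLinearMap.mul ℝ ℝ, volume] deriv φ :=
  funext fun t => (hφ.2.1.hasDerivAt_convolution_right (ContinuousLinearMap.mul ℝ ℝ)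
    (locallyIntegrable_kernelRL hγ) (hφ.1.of_le (by exact_mod_cast le_top)) t).deriv

lemma testFunctions_integral_Iio_deriv {T : ℝ} {φ : ℝ → ℝ} (hφ : φ ∈ testFunctions T) (t : ℝ) :
    ∫ s in Iio t, deriv φ s = φ t := by
  rw [← integral_Iic_eq_integral_Iio]
  exact hφ.2.1.integral_Iic_deriv_eq (hφ.1.of_le (by exact_mod_cast le_top)) t

lemma testFunctions_integrable_deriv {T : ℝ} {φ : ℝ → ℝ} (hφ : φ ∈ testFunctions T) :
    Integrable (deriv φ) :=
  (hφ.1.continuous_deriv (by exact_mod_cast le_top)).integrable_of_hasCompactSupport hφ.2.1.deriv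

lemma integral_kernelRL_one_mul (g : ℝ → ℝ) (t : ℝ) :
    ∫ s, kernelRL 1 (t - s) * g s = ∫ s in Iio t, g s := by
  rw [← integral_indicator measurableSet_Iio]
  congr 1
  funext s
  by_cases hs : s < t
  · rw [kernelRL_of_pos _ (by linarith), indicator_of_mem (by simpa using hs), sub_self,
      Real.rpow_zero, one_mul]
  · rw [kernelRL_of_nonpos _ (by linarith), indicator_of_notMem (by simpa using hs), zero_mul]

lemma leftRLDeriv_one_of_mem {T : ℝ} {φ : ℝ → ℝ} (hφ : φ ∈ testFunctions T) :
    leftRLDeriv 1 φ = deriv φ := by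
  unfold leftRLDeriv
  have h1 : ((⌊(1 : ℝ)⌋₊ + 1 : ℕ) : ℝ) - 1 = 1 := by
    rw [Nat.floor_one]
    norm_num
  rw [h1, leftRLInt_eq_convolution hφ, Nat.floor_one, iteratedDeriv_succ', iteratedDeriv_one]
  congr 1
  simp only [Real.Gamma_one, div_one, one_mul]
  rw [deriv_convolution_kernelRL one_pos hφ]
  funext t
  rw [convolution_kernelRL_apply, integral_kernelRL_one_mul, testFunctions_integral_Iio_deriv hφ]

lemma floor_eq_zero_of_mem {α : ℝ} (hα : α ∈ Ioo (0 : ℝ) 1) : ⌊α⌋₊ = 0 :=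
  Nat.floor_eq_zero.2 hα.2

lemma leftRLDeriv_of_mem {α T : ℝ} (hα : α ∈ Ioo (0 : ℝ) 1) {φ : ℝ → ℝ}
    (hφ : φ ∈ testFunctions T) (t : ℝ) :
    leftRLDeriv α φ t
      = 1 / Real.Gamma (1 - α) * ∫ s, kernelRL (1 - α) (t - s) * deriv φ s := by
  have h1 : ((0 + 1 : ℕ) : ℝ) - α = 1 - α := by norm_num
  rw [leftRLDeriv, floor_eq_zero_of_mem hα, h1, leftRLInt_eq_convolution hφ, zero_add,
    iteratedDeriv_one]
  have h2 := hφ.2.1.hasDerivAt_convolution_right (ContinuousLinearMap.mul ℝ ℝ)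
    (locallyIntegrable_kernelRL (sub_pos.2 hα.2)) (hφ.1.of_le (by exact_mod_cast le_top)) t
  rw [(h2.const_mul _).deriv, convolution_kernelRL_apply]

lemma leftRLDeriv_eq_zero {α T : ℝ} (hα : α ∈ Ioc (0 : ℝ) 1) {φ : ℝ → ℝ}
    (hφ : φ ∈ testFunctions T) {t : ℝ} (ht : t ≤ 0) : leftRLDeriv α φ t = 0 := by
  have h0 : ∀ s ≤ 0, deriv φ s = 0 := by
    intro s hs
    by_contra h
    exact absurd (hφ.2.2 (support_deriv_subset h)).1 (not_lt.2 hs)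
  rcases hα.2.lt_or_eq with h1 | rfl
  · rw [leftRLDeriv_of_mem ⟨hα.1, h1⟩ hφ]
    have : ∀ s, kernelRL (1 - α) (t - s) * deriv φ s = 0 := by
      intro s
      rcases le_or_gt s 0 with h | h
      · rw [h0 s h, mul_zero]
      · rw [kernelRL_of_nonpos _ (by linarith), zero_mul]
    simp [this]
  · rw [leftRLDeriv_one_of_mem hφ, h0 t ht]

/-- Test functions are the fractional integrals of their fractional derivatives. -/
lemma testFunctions_eq_integral_leftRLDeriv {α T : ℝ} (hα : α ∈ Ioc (0 : ℝ) 1) {φ : ℝ → ℝ}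
    (hφ : φ ∈ testFunctions T) {t : ℝ} (ht : t ≤ T) :
    φ t = 1 / Real.Gamma α * ∫ s in Icc 0 T, kernelRL α (t - s) * leftRLDeriv α φ s := by
  have h1 : ∫ s in Icc 0 T, kernelRL α (t - s) * leftRLDeriv α φ s
      = ∫ s, kernelRL α (t - s) * leftRLDeriv α φ s := by
    refine setIntegral_eq_integral_of_forall_compl_eq_zero fun s hs => ?_
    rcases le_or_gt s 0 with h | h
    · rw [leftRLDeriv_eq_zero hα hφ h, mul_zero]
    · rw [kernelRL_of_nonpos _ (by
        by_contra h'
        exact hs ⟨h.le, by linarith⟩), zero_mul]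
  rw [h1]
  rcases hα.2.lt_or_eq with h2 | rfl
  · have hα' : α ∈ Ioo (0 : ℝ) 1 := ⟨hα.1, h2⟩
    have h3 := (Real.Gamma_pos_of_pos hα.1).ne'
    have h4 := (Real.Gamma_pos_of_pos (sub_pos.2 h2)).ne'
    simp only [leftRLDeriv_of_mem hα' hφ, mul_left_comm (kernelRL α _), integral_const_mul]
    rw [integral_kernelRL_integral_kernelRL hα' (testFunctions_integrable_deriv hφ),
      testFunctions_integral_Iio_deriv hφ]
    field_simp
  · rw [leftRLDeriv_one_of_mem hφ, integral_kernelRL_one_mul,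
      testFunctions_integral_Iio_deriv hφ]
    simp

/-! ### The fractional integral as a compact operator into the continuous functions -/

/-- The exponent conjugate to `p`, as an exponent of a Lebesgue space. -/
abbrev conjExp (p : ℝ) : ℝ≥0∞ := ENNReal.ofReal p.conjExponent

instance holderConjugate_conjExp (p : ℝ) [hp : Fact (1 < p)] :
    ENNReal.HolderConjugate (conjExp p) (ENNReal.ofReal p) :=
  (Real.HolderConjugate.conjExponent hp.out).symm.ennrealOfReal

instance one_le_conjExp (p : ℝ) [hp : Fact (1 < p)] : Fact (1 ≤ conjExp p) :=
  ⟨ENNReal.one_le_ofReal.2 (Real.HolderConjugate.conjExponent hp.out).symm.lt.le⟩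

/-- The kernel of the fractional integral, restricted to `(0, T]`: only this part matters on
`[0, T]`, and it belongs to the dual Lebesgue space. -/
def truncKernel (α T : ℝ) : ℝ → ℝ := (Iic T).indicator (kernelRL α)

/-- The condition `1 / p < α` is what makes the kernel `q`-integrable near the origin, `q` being the
exponent conjugate to `p`. -/
lemma memLp_truncKernel (p α T : ℝ) [hp : Fact (1 < p)] (hα : 1 / p < α) :
    MemLp (truncKernel α T) (conjExp p) volume := by
  have hpq := Real.HolderConjugate.conjExponent hp.out
  have hq : 0 < p.conjExponent := hpq.symm.pos
  have hm : Measurable (truncKernel α T) := (measurable_kernelRL α).indicator measurableSet_Iic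
  rw [← integrable_norm_rpow_iff hm.aestronglyMeasurable (by simpa using hq)
    ENNReal.ofReal_ne_top, ENNReal.toReal_ofReal hq.le]
  have h1 : -1 < (α - 1) * p.conjExponent := by
    have h2 : p⁻¹ + p.conjExponent⁻¹ = 1 := hpq.inv_add_inv_eq_one
    have h3 : p.conjExponent⁻¹ * p.conjExponent = 1 := inv_mul_cancel₀ hq.ne'
    rw [one_div] at hα
    nlinarith
  have h2 := intervalIntegral.intervalIntegrable_rpow' (a := 0) (b := |T|) h1
  rw [intervalIntegrable_iff_integrableOn_Ioc_of_le (abs_nonneg T),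
    ← integrable_indicator_iff measurableSet_Ioc] at h2
  refine (h2.indicator (measurableSet_Iic (a := T))).congr (Eventually.of_forall fun s => ?_)
  by_cases hs : s ≤ T
  · rcases le_or_gt s 0 with h0 | h0
    · simp [truncKernel, hs, kernelRL_of_nonpos α h0, not_lt.2 h0, hq.ne']
    · have : s ∈ Ioc 0 |T| := ⟨h0, hs.trans (le_abs_self T)⟩
      simp only [truncKernel, mem_Iic, hs, indicator_of_mem, this, kernelRL_of_pos α h0]
      rw [Real.norm_of_nonneg (Real.rpow_nonneg h0.le _), Real.rpow_mul h0.le]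
  · simp [truncKernel, hs, hq.ne']

/-- The reflection `s ↦ t - s`. -/
def reflectAt : C(ℝ, C(ℝ, ℝ)) :=
  ContinuousMap.curry ⟨fun x : ℝ × ℝ => x.1 - x.2, continuous_fst.sub continuous_snd⟩

lemma measurePreserving_reflectAt (t : ℝ) :
    MeasurePreserving (reflectAt t) volume volume :=
  Measure.measurePreserving_sub_left volume t

/-- The function `s ↦ (t - s)^(α - 1)`, cut off, as an element of the dual Lebesgue space of
`L^p([0, T])`. -/
def kernelLp {p α : ℝ} [Fact (1 < p)] (hα : 1 / p < α) (T t : ℝ) :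
    Lp ℝ (conjExp p) (volume.restrict (Icc (0 : ℝ) T)) :=
  LpToLpRestrictCLM ℝ ℝ ℝ volume (conjExp p) (Icc 0 T)
    (Lp.compMeasurePreserving (reflectAt t) (measurePreserving_reflectAt t)
      ((memLp_truncKernel p α T hα).toLp _))

lemma coeFn_kernelLp {p α : ℝ} [Fact (1 < p)] (hα : 1 / p < α) (T t : ℝ) :
    kernelLp hα T t =ᵐ[volume.restrict (Icc 0 T)] fun s => truncKernel α T (t - s) := by
  refine (LpToLpRestrictCLM_coeFn ℝ _ _).trans (ae_restrict_of_ae ?_)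
  refine (Lp.coeFn_compMeasurePreserving _ (measurePreserving_reflectAt t)).trans ?_
  exact (measurePreserving_reflectAt t).quasiMeasurePreserving.ae_eq_comp
    (memLp_truncKernel p α T hα).coeFn_toLp

lemma continuous_kernelLp {p α : ℝ} [Fact (1 < p)] (hα : 1 / p < α) (T : ℝ) :
    Continuous (kernelLp hα T) :=
  (LpToLpRestrictCLM ℝ ℝ ℝ volume (conjExp p) (Icc 0 T)).continuous.comp
    (continuous_const.compMeasurePreservingLp reflectAt.continuous measurePreserving_reflectAt
      ENNReal.ofReal_ne_top)

lemma exists_norm_kernelLp_le {p α : ℝ} [Fact (1 < p)] (hα : 1 / p < α) (T : ℝ) :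
    ∃ C, ∀ t, ‖kernelLp hα T t‖ ≤ C := by
  refine ⟨‖LpToLpRestrictCLM ℝ ℝ ℝ volume (conjExp p) (Icc 0 T)‖ *
    ‖(memLp_truncKernel p α T hα).toLp _‖, fun t => ?_⟩
  refine (ContinuousLinearMap.le_opNorm _ _).trans_eq ?_
  rw [Lp.norm_compMeasurePreserving]

/-- The dual pairing of `L^q([0, T])` and `L^p([0, T])`. -/
abbrev pairing (p T : ℝ) [Fact (1 < p)] :
    Lp ℝ (conjExp p) (volume.restrict (Icc (0 : ℝ) T)) →L[ℝ] LpT p T →L[ℝ] ℝ :=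
  (ContinuousLinearMap.mul ℝ ℝ).lpPairing (volume.restrict (Icc (0 : ℝ) T)) (conjExp p)
    (ENNReal.ofReal p)

/-- The projection of the line to `[0, T]`. -/
def clamp (T t : ℝ) : ℝ := max 0 (min T t)

lemma continuous_clamp (T : ℝ) : Continuous (clamp T) :=
  continuous_const.max (continuous_const.min continuous_id)

lemma clamp_mem {T : ℝ} (hT : 0 < T) (t : ℝ) : clamp T t ∈ Icc 0 T :=
  ⟨le_max_left _ _, max_le hT.le (min_le_left _ _)⟩

lemma clamp_of_mem {T t : ℝ} (ht : t ∈ Icc 0 T) : clamp T t = t := by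
  rw [clamp, min_eq_right ht.2, max_eq_right ht.1]

/-- A bounded continuous family of functionals, seen as an operator with values in the bounded
continuous functions of the parameter. -/
def ofFunctionals {X : Type*} [NormedAddCommGroup X] [NormedSpace ℝ X] (L : ℝ → X →L[ℝ] ℝ)
    (hL : Continuous L) {C : ℝ} (hC : ∀ t, ‖L t‖ ≤ C) :
    X →L[ℝ] BoundedContinuousFunction ℝ ℝ :=
  LinearMap.mkContinuous
    { toFun := fun w => BoundedContinuousFunction.ofNormedAddCommGroup (fun t => L t w)
        (hL.clm_apply continuous_const) (C * ‖w‖) (fun t => (L t).le_of_opNorm_le (hC t) w)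
      map_add' := fun v w => by
        ext t
        simp
      map_smul' := fun c w => by
        ext t
        simp }
    C (fun w => BoundedContinuousFunction.norm_ofNormedAddCommGroup_le _
      (mul_nonneg ((norm_nonneg _).trans (hC 0)) (norm_nonneg w))
      (fun t => (L t).le_of_opNorm_le (hC t) w))

/-- The value at the point `t` of `[0, T]` of the fractional integral of order `α > 1 / p`, as a
functional on `L^p([0, T])`. -/
def fracIntEval {p α : ℝ} [Fact (1 < p)] (hα : 1 / p < α) (T t : ℝ) : LpT p T →L[ℝ] ℝ :=
  (1 / Real.Gamma α) • pairing p T (kernelLp hα T (clamp T t))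

lemma continuous_fracIntEval {p α : ℝ} [Fact (1 < p)] (hα : 1 / p < α) (T : ℝ) :
    Continuous (fracIntEval hα T) :=
  ((pairing p T).continuous.comp
    ((continuous_kernelLp hα T).comp (continuous_clamp T))).const_smul (1 / Real.Gamma α)

lemma exists_norm_fracIntEval_le {p α : ℝ} [Fact (1 < p)] (hα : 1 / p < α) (T : ℝ) :
    ∃ C, ∀ t, ‖fracIntEval hα T t‖ ≤ C := by
  obtain ⟨C, hC⟩ := exists_norm_kernelLp_le hα T
  refine ⟨|1 / Real.Gamma α| * (‖pairing p T‖ * C), fun t => ?_⟩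
  rw [fracIntEval, norm_smul]
  refine mul_le_mul_of_nonneg_left ?_ (abs_nonneg _)
  exact ((pairing p T).le_opNorm _).trans (mul_le_mul_of_nonneg_left (hC _) (norm_nonneg _))

/-- The fractional integral of order `α > 1 / p` as a bounded operator from `L^p([0, T])` to
bounded continuous functions. The fractional integral of a function on `[0, T]` is extended to the
line by its values at the end points. -/
def fracInt {p α : ℝ} [Fact (1 < p)] (hα : 1 / p < α) (T : ℝ) :
    LpT p T →L[ℝ] BoundedContinuousFunction ℝ ℝ :=
  ofFunctionals (fracIntEval hα T) (continuous_fracIntEval hα T)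
    (exists_norm_fracIntEval_le hα T).choose_spec

lemma fracInt_eq {p α : ℝ} [Fact (1 < p)] (hα : 1 / p < α) (T : ℝ) (w : LpT p T) (t : ℝ) :
    fracInt hα T w t = fracIntEval hα T t w := rfl

lemma fracInt_apply {p α : ℝ} [Fact (1 < p)] (hα : 1 / p < α) {T : ℝ} (w : LpT p T)
    {t : ℝ} (ht : t ∈ Icc 0 T) :
    fracInt hα T w t = 1 / Real.Gamma α * ∫ s in Icc 0 T, kernelRL α (t - s) * w s := by
  rw [fracInt_eq, fracIntEval, _root_.smul_apply, smul_eq_mul,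
    ContinuousLinearMap.lpPairing_eq_integral, clamp_of_mem ht]
  congr 1
  refine integral_congr_ae ?_
  filter_upwards [coeFn_kernelLp hα T t, ae_restrict_mem measurableSet_Icc] with s hs hs'
  -- The cut-off is inactive: `t - s ≤ T` for `s`, `t` in `[0, T]`.
  rw [hs, truncKernel, indicator_of_mem (by
    simp only [mem_Iic]
    linarith [hs'.1, ht.2])]
  rfl

/-- Bounded subsets of `L^p([0, T])` have relatively compact images under the fractional integral:
by Hölder's inequality the images are equicontinuous, since translations are continuous in
`L^q`. -/
lemma exists_isCompact_fracInt_image {p α : ℝ} [Fact (1 < p)] (hα : 1 / p < α) {T : ℝ}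
    (hT : 0 < T) (R : ℝ) :
    ∃ K : Set (BoundedContinuousFunction ℝ ℝ), IsCompact K ∧
      ∀ w : LpT p T, ‖w‖ ≤ R → fracInt hα T w ∈ K := by
  let ι : C(Icc (0 : ℝ) T, ℝ) := ⟨Subtype.val, continuous_subtype_val⟩
  let π : C(ℝ, Icc (0 : ℝ) T) :=
    ⟨fun t => ⟨clamp T t, clamp_mem hT t⟩, (continuous_clamp T).subtype_mk _⟩
  let A : Set (BoundedContinuousFunction (Icc (0 : ℝ) T) ℝ) :=
    (fun w : LpT p T => (fracInt hα T w).compContinuous ι) '' {w | ‖w‖ ≤ R}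
  have hA : IsCompact (closure A) := by
    refine BoundedContinuousFunction.arzela_ascoli
      (Metric.closedBall 0 (‖fracInt hα T‖ * R)) (isCompact_closedBall _ _) A ?_ ?_
    · rintro _ t ⟨w, hw, rfl⟩
      rw [mem_closedBall_zero_iff]
      refine ((fracInt hα T w).norm_coe_le_norm _).trans
        (((fracInt hα T).le_opNorm w).trans ?_)
      exact mul_le_mul_of_nonneg_left hw (norm_nonneg _)
    · intro t₀
      have hlim : Tendsto (fun t : Icc (0 : ℝ) T =>
          ‖fracIntEval (p := p) hα T t - fracIntEval hα T t₀‖ * R) (𝓝 t₀) (𝓝 0) := by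
        have hc : Continuous fun t : Icc (0 : ℝ) T =>
            ‖fracIntEval (p := p) hα T t - fracIntEval hα T t₀‖ * R :=
          ((((continuous_fracIntEval hα T).comp continuous_subtype_val).sub
            continuous_const).norm).mul continuous_const
        convert hc.tendsto t₀ using 2
        simp
      refine Metric.equicontinuousAt_of_continuity_modulus _ hlim _ (Eventually.of_forall ?_)
      rintro t ⟨_, w, hw, rfl⟩
      have hw' : ‖w‖ ≤ R := hw
      simp only [BoundedContinuousFunction.compContinuous_apply, fracInt_eq, ι,
        ContinuousMap.coe_mk]
      rw [dist_comm, dist_eq_norm, ← _root_.sub_apply]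
      refine (ContinuousLinearMap.le_opNorm _ w).trans ?_
      gcongr
  refine ⟨_, hA.image (BoundedContinuousFunction.continuous_compContinuous π), fun w hw => ?_⟩
  refine ⟨_, subset_closure ⟨w, hw, rfl⟩, ?_⟩
  ext t
  simp only [BoundedContinuousFunction.compContinuous_apply, fracInt_eq, fracIntEval,
    ι, π, ContinuousMap.coe_mk, clamp_of_mem (clamp_mem hT t)]

/-! ### The structure of the fractional derivative space -/

/-- The map `w ↦ (I^α w, w)`, where `I^α` is the fractional integral. -/
def potential {p α : ℝ} [Fact (1 < p)] (hα : 1 / p < α) (T : ℝ) : LpT p T →L[ℝ] LpPair p T :=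
  (WithLp.prodContinuousLinearEquiv (ENNReal.ofReal p) ℝ (LpT p T)
      (LpT p T)).symm.toContinuousLinearMap.comp
    (((BoundedContinuousFunction.toLp (ENNReal.ofReal p) (volume.restrict (Icc (0 : ℝ) T)) ℝ) ∘L
      fracInt hα T).prod (ContinuousLinearMap.id ℝ _))

/-- The second component `₀D_t^α u` of a pair `(u, ₀D_t^α u)`. -/
def sndL (p T : ℝ) [Fact (1 < p)] : LpPair p T →L[ℝ] LpT p T :=
  ContinuousLinearMap.snd ℝ (LpT p T) (LpT p T) ∘L
    (WithLp.prodContinuousLinearEquiv (ENNReal.ofReal p) ℝ (LpT p T)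
      (LpT p T)).toContinuousLinearMap

lemma potential_fst {p α : ℝ} [Fact (1 < p)] (hα : 1 / p < α) {T : ℝ} (w : LpT p T) :
    (potential hα T w).fst = BoundedContinuousFunction.toLp (ENNReal.ofReal p)
      (volume.restrict (Icc (0 : ℝ) T)) ℝ (fracInt hα T w) := rfl

lemma pos_of_one_div_lt {p α : ℝ} [hp : Fact (1 < p)] (hα : 1 / p < α) : 0 < α :=
  (one_div_pos.2 (one_pos.trans hp.out)).trans hα

/-- Every element of `E_0^{α,p}` is a pair `(I^α w, w)`. This holds for test functions and passes to
the closure. -/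
lemma potential_snd_eq {p α T : ℝ} [Fact (1 < p)] (hα : α ∈ Ioc (1 / p) 1)
    (u : FracSpace α p T) :
    potential hα.1 T (u : LpPair p T).snd = u := by
  have hcl : IsClosed {x : LpPair p T | potential hα.1 T (sndL p T x) = x} :=
    isClosed_eq ((potential hα.1 T).continuous.comp (sndL p T).continuous) continuous_id
  have hsub : (LinearMap.range (graphMap α p T) : Set (LpPair p T)) ⊆
      {x : LpPair p T | potential hα.1 T (sndL p T x) = x} := by
    rintro _ ⟨φ, rfl⟩
    have h1 : (potential hα.1 T (graphMap α p T φ).snd).fst = (graphMap α p T φ).fst := by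
      rw [potential_fst]
      refine Lp.ext ?_
      have e1 := (memLp_of_continuous (ENNReal.ofReal p) T φ.2.1.continuous).coeFn_toLp
      have e2 := (memLp_of_continuous (ENNReal.ofReal p) T
        (continuous_leftRLDeriv α φ.2)).coeFn_toLp
      refine (BoundedContinuousFunction.coeFn_toLp _ _ _ _).trans (EventuallyEq.trans ?_ e1.symm)
      filter_upwards [ae_restrict_mem measurableSet_Icc] with t ht
      rw [fracInt_apply hα.1 _ ht, testFunctions_eq_integral_leftRLDeriv
        ⟨pos_of_one_div_lt hα.1, hα.2⟩ φ.2 ht.2]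
      congr 1
      refine integral_congr_ae ?_
      filter_upwards [e2] with s hs
      exact congrArg _ hs
    exact (WithLp.ofLp_injective _) (Prod.ext h1 rfl)
  exact closure_minimal hsub hcl u.2

/-- The continuous representative of an element of `E_0^{α,p}`. -/
def embed {p α : ℝ} [Fact (1 < p)] (hα : 1 / p < α) (T : ℝ) :
    FracSpace α p T →L[ℝ] BoundedContinuousFunction ℝ ℝ :=
  fracInt hα T ∘L sndL p T ∘L (FracSpace α p T).subtypeL

lemma toLpT_ae_eq_embed {p α T : ℝ} [Fact (1 < p)] (hα : α ∈ Ioc (1 / p) 1)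
    (u : FracSpace α p T) :
    toLpT u =ᵐ[volume.restrict (Icc 0 T)] embed hα.1 T u := by
  have h : toLpT u = BoundedContinuousFunction.toLp (ENNReal.ofReal p)
      (volume.restrict (Icc (0 : ℝ) T)) ℝ (embed hα.1 T u) :=
    (congrArg WithLp.fst (potential_snd_eq hα u)).symm.trans (potential_fst hα.1 _)
  rw [h]
  exact BoundedContinuousFunction.coeFn_toLp _ _ _ _

lemma integrable_indicator_Lp {p T : ℝ} [hp : Fact (1 < p)] (w : LpT p T) :
    Integrable ((Icc 0 T).indicator w) :=
  (integrable_indicator_iff measurableSet_Icc).2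
    ((Lp.memLp w).integrable (ENNReal.one_le_ofReal.2 hp.out.le))

lemma fracInt_apply_indicator {p α : ℝ} [Fact (1 < p)] (hα : 1 / p < α) {T : ℝ} (w : LpT p T)
    {t : ℝ} (ht : t ∈ Icc 0 T) :
    fracInt hα T w t
      = 1 / Real.Gamma α * ∫ s, kernelRL α (t - s) * (Icc 0 T).indicator w s := by
  rw [fracInt_apply hα w ht, ← integral_indicator measurableSet_Icc]
  congr 2
  funext s
  by_cases hs : s ∈ Icc 0 T
  · rw [indicator_of_mem hs, indicator_of_mem hs]
  · rw [indicator_of_notMem hs, indicator_of_notMem hs, mul_zero]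

lemma integral_Iio_indicator {T t : ℝ} (ht : 0 ≤ t) (w : ℝ → ℝ) :
    ∫ s in Iio t, (Icc 0 T).indicator w s = ∫ s in (0 : ℝ)..t, (Icc 0 T).indicator w s := by
  rw [intervalIntegral.integral_of_le ht, integral_Ioc_eq_integral_Ioo,
    ← integral_Ico_eq_integral_Ioo]
  exact setIntegral_eq_of_subset_of_forall_sdiff_eq_zero measurableSet_Iio
    (fun s hs => hs.2) (fun s hs => indicator_of_notMem (fun h => hs.2 ⟨h.1, hs.1⟩) _)

lemma ae_hasDerivAt_integral_indicator {p T : ℝ} [Fact (1 < p)] (w : LpT p T) :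
    ∀ᵐ t ∂(volume.restrict (Icc 0 T)), t ∈ Ioo 0 T ∧
      HasDerivAt (fun x => ∫ s in (0 : ℝ)..x, (Icc 0 T).indicator w s) (w t) t := by
  have h1 := LocallyIntegrable.ae_hasDerivAt_integral
    (integrable_indicator_Lp w).locallyIntegrable
  have h2 : ∀ᵐ t ∂(volume.restrict (Icc 0 T)), t ∈ Ioo 0 T := by
    rw [← restrict_Ioo_eq_restrict_Icc]
    exact ae_restrict_mem measurableSet_Ioo
  filter_upwards [ae_restrict_of_ae h1, h2] with t ht ht'
  refine ⟨ht', ?_⟩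
  have := ht 0
  rwa [indicator_of_mem (Ioo_subset_Icc_self ht')] at this

/-- The fractional derivative of an element of `E_0^{α,p}`, computed by the pointwise
Riemann–Liouville formula, agrees with its second component: the fractional integral of
complementary order of `I^α w` is the primitive of `w`, which is differentiable almost everywhere
by Lebesgue's theorem. -/
lemma leftRLDeriv_toLpT_ae_eq {p α T : ℝ} [Fact (1 < p)] (hα : α ∈ Ioc (1 / p) 1)
    (u : FracSpace α p T) :
    leftRLDeriv α (toLpT u) =ᵐ[volume.restrict (Icc 0 T)] (u : LpPair p T).snd := by
  set w := (u : LpPair p T).snd with hw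
  have hu : ∀ᵐ s, s ∈ Icc 0 T → toLpT u s = fracInt hα.1 T w s := by
    have := toLpT_ae_eq_embed hα u
    rwa [EventuallyEq, ae_restrict_iff' measurableSet_Icc] at this
  have hα0 : 0 < α := pos_of_one_div_lt hα.1
  -- The pointwise derivative sees the values of the fractional integral at all nearby points, so
  -- the identity with the primitive of `w` is needed everywhere on `[0, T]`.
  rcases hα.2.lt_or_eq with h1 | rfl
  · have hα' : 1 - α ∈ Ioo (0 : ℝ) 1 := ⟨by linarith, by linarith⟩
    have hg1 := (Real.Gamma_pos_of_pos hα0).ne'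
    have hg2 := (Real.Gamma_pos_of_pos hα'.1).ne'
    have hI : ∀ t ∈ Icc 0 T, leftRLInt (1 - α) (toLpT u) t
        = ∫ s in (0 : ℝ)..t, (Icc 0 T).indicator w s := by
      intro t ht
      have e1 : ∫ s, kernelRL (1 - α) (t - s) * (Ioi (0 : ℝ)).indicator (toLpT u) s
          = ∫ r, 1 / Real.Gamma α * (kernelRL (1 - α) (t - r) *
            ∫ s, kernelRL (1 - (1 - α)) (r - s) * (Icc 0 T).indicator w s) := by
        refine integral_congr_ae ?_
        filter_upwards [hu] with r hr
        rcases le_or_gt r 0 with h0 | h0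
        · have : ∀ s, kernelRL (1 - (1 - α)) (r - s) * (Icc 0 T).indicator w s = 0 := by
            intro s
            by_cases hs : s ∈ Icc 0 T
            · rw [kernelRL_of_nonpos _ (by linarith [hs.1]), zero_mul]
            · rw [indicator_of_notMem hs, mul_zero]
          rw [indicator_of_notMem (show r ∉ Ioi (0 : ℝ) by simpa using h0), funext this,
            integral_zero, mul_zero, mul_zero]
        · rcases le_or_gt t r with h2 | h2
          · rw [kernelRL_of_nonpos _ (by linarith), zero_mul, zero_mul, mul_zero]
          · have hrm : r ∈ Icc 0 T := ⟨h0.le, h2.le.trans ht.2⟩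
            rw [indicator_of_mem (show r ∈ Ioi (0 : ℝ) from h0), hr hrm,
              fracInt_apply_indicator hα.1 w hrm, sub_sub_cancel]
            ring
      rw [leftRLInt_eq_integral ht.1, e1, integral_const_mul,
        integral_kernelRL_integral_kernelRL hα' (integrable_indicator_Lp w),
        integral_Iio_indicator ht.1, sub_sub_cancel]
      field_simp
    filter_upwards [ae_hasDerivAt_integral_indicator w] with t ht
    have e2 : ((0 + 1 : ℕ) : ℝ) - α = 1 - α := by norm_num
    rw [leftRLDeriv, floor_eq_zero_of_mem ⟨hα0, h1⟩, e2, zero_add, iteratedDeriv_one,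
      ← ht.2.deriv]
    refine EventuallyEq.deriv_eq ?_
    filter_upwards [Icc_mem_nhds ht.1.1 ht.1.2] with s hs using hI s hs
  -- For `α = 1` the derivative is the second derivative of the primitive of `u`.
  · have hI : ∀ t ∈ Icc 0 T, leftRLInt 1 (toLpT u) t
        = ∫ s in (0 : ℝ)..t, fracInt hα.1 T w s := by
      intro t ht
      simp only [leftRLInt, sub_self, Real.rpow_zero, one_mul, Real.Gamma_one, div_one]
      refine intervalIntegral.integral_congr_ae ?_
      filter_upwards [hu] with s hs hs'
      rw [uIoc_of_le ht.1] at hs'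
      exact hs ⟨hs'.1.le, hs'.2.trans ht.2⟩
    have hI2 : ∀ t ∈ Ioo 0 T, deriv (leftRLInt 1 (toLpT u)) t
        = ∫ s in (0 : ℝ)..t, (Icc 0 T).indicator w s := by
      intro t ht
      have e1 : leftRLInt 1 (toLpT u) =ᶠ[𝓝 t] fun t => ∫ s in (0 : ℝ)..t, fracInt hα.1 T w s := by
        filter_upwards [Icc_mem_nhds ht.1 ht.2] with s hs using hI s hs
      rw [e1.deriv_eq, (fracInt hα.1 T w).continuous.deriv_integral _ 0 t,
        fracInt_apply_indicator hα.1 w (Ioo_subset_Icc_self ht), integral_kernelRL_one_mul,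
        integral_Iio_indicator ht.1.le]
      simp
    filter_upwards [ae_hasDerivAt_integral_indicator w] with t ht
    have e2 : ((⌊(1 : ℝ)⌋₊ + 1 : ℕ) : ℝ) - 1 = 1 := by
      rw [Nat.floor_one]
      norm_num
    rw [leftRLDeriv, e2, Nat.floor_one, iteratedDeriv_succ', iteratedDeriv_one, ← ht.2.deriv]
    refine EventuallyEq.deriv_eq ?_
    filter_upwards [Ioo_mem_nhds ht.1.1 ht.1.2] with s hs using hI2 s hs

/-! ### Pointwise inequalities for the `p`-th power -/

section Lebesgue

/-- First order expansion of `|x|^p`, with an error that is homogeneous of degree `p`. -/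
lemma exists_abs_rpow_expansion {p ε : ℝ} (hp : 1 < p) (hε : 0 < ε) :
    ∃ C, 0 ≤ C ∧ ∀ a b : ℝ, |(|a + b| ^ p - |a| ^ p - p * |a| ^ (p - 2) * a * b)|
      ≤ ε * (|b| * |a| ^ (p - 1)) + C * |b| ^ p := by
  have hp0 : 0 < p := by linarith
  have key : ∃ C, 1 ≤ C ∧ ∀ x : ℝ, |(|1 + x| ^ p - 1 - p * x)| ≤ ε * |x| + C * |x| ^ p := by
    have hd := hasDerivAt_abs_rpow 1 hp
    rw [hasDerivAt_iff_isLittleO_nhds_zero] at hd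
    have h1 := hd.bound hε
    obtain ⟨δ, hδ, h2⟩ := Metric.eventually_nhds_iff.1 h1
    set d := min δ 1 with hd'
    have hd0 : 0 < d := lt_min hδ one_pos
    have hd1 : d ≤ 1 := min_le_right _ _
    have h2p : 0 ≤ (2 : ℝ) ^ p := by positivity
    have hdp : 0 < d ^ p := Real.rpow_pos_of_pos hd0 _
    have hdp1 : d ^ p ≤ 1 := Real.rpow_le_one hd0.le hd1 hp0.le
    refine ⟨(2 ^ p + 1 + p) / d ^ p, ?_, fun x => ?_⟩
    · rw [le_div_iff₀ hdp]
      linarith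
    have hxp : 0 ≤ |x| ^ p := by positivity
    rcases lt_or_ge |x| d with hx | hx
    · have h3 := h2 (y := x) (by simpa using hx.trans_le (min_le_left _ _))
      have h4 : |(|1 + x| ^ p - 1 - p * x)| ≤ ε * |x| := by
        simpa [mul_comm] using h3
      have : 0 ≤ (2 ^ p + 1 + p) / d ^ p * |x| ^ p := by positivity
      linarith
    -- Away from `0` every term is at most a constant times `(|x| / d)^p`, as `|x| / d ≥ 1`.
    · set y := |x| / d with hy
      have hy1 : 1 ≤ y := by rwa [hy, one_le_div hd0]
      have hxy : |x| ≤ y := by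
        rw [hy, le_div_iff₀ hd0]
        nlinarith [abs_nonneg x]
      have hyp : y ^ p = |x| ^ p / d ^ p := Real.div_rpow (abs_nonneg _) hd0.le _
      have e1 : |1 + x| ^ p ≤ 2 ^ p * y ^ p := by
        rw [← Real.mul_rpow (by norm_num) (by linarith)]
        refine Real.rpow_le_rpow (abs_nonneg _) ?_ hp0.le
        have := abs_add_le 1 x
        rw [abs_one] at this
        linarith
      have e2 : 1 ≤ y ^ p := Real.one_le_rpow hy1 hp0.le
      have e3 : y ≤ y ^ p := Real.self_le_rpow_of_one_le hy1 hp.le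
      have e4 : (2 ^ p + 1 + p) / d ^ p * |x| ^ p = (2 ^ p + 1 + p) * y ^ p := by
        rw [hyp]
        ring
      rw [e4]
      have e5 : p * |x| ≤ p * y ^ p := mul_le_mul_of_nonneg_left (hxy.trans e3) hp0.le
      have e6 : 0 ≤ ε * |x| := by positivity
      have e7 : |p * x| = p * |x| := by rw [abs_mul, abs_of_pos hp0]
      have e8 : |(|1 + x| ^ p - 1 - p * x)| ≤ |1 + x| ^ p + 1 + p * |x| := by
        refine (abs_sub _ _).trans ?_
        rw [e7]
        refine add_le_add_left ((abs_sub _ _).trans ?_) _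
        rw [abs_one, abs_of_nonneg (by positivity)]
      linarith
  obtain ⟨C, hC1, hC⟩ := key
  refine ⟨C, by linarith, fun a b => ?_⟩
  rcases eq_or_ne a 0 with rfl | ha
  · have : 0 ≤ |b| ^ p := by positivity
    simp only [zero_add, abs_zero, Real.zero_rpow hp0.ne', sub_zero, mul_zero, zero_mul,
      Real.zero_rpow (sub_pos.2 hp).ne', abs_of_nonneg this]
    nlinarith
  · have ha' : 0 < |a| := abs_pos.2 ha
    have h1 := hC (b / a)
    have e1 : |a + b| ^ p = |a| ^ p * |1 + b / a| ^ p := by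
      rw [← Real.mul_rpow ha'.le (abs_nonneg _), ← abs_mul]
      congr 2
      field_simp
    have e2 : p * |a| ^ (p - 2) * a * b = |a| ^ p * (p * (b / a)) := by
      have : |a| ^ p = |a| ^ (p - 2) * a ^ 2 := by
        rw [← sq_abs, ← Real.rpow_natCast, ← Real.rpow_add ha']
        congr 1
        push_cast
        ring
      rw [this]
      field_simp
    have e3 : |b| * |a| ^ (p - 1) = |a| ^ p * |b / a| := by
      rw [Real.rpow_sub ha', Real.rpow_one, abs_div]
      ring
    have e4 : |b| ^ p = |a| ^ p * |b / a| ^ p := by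
      rw [← Real.mul_rpow ha'.le (abs_nonneg _), ← abs_mul]
      congr 2
      field_simp
    have hap : 0 ≤ |a| ^ p := by positivity
    rw [e1, e2, e3, e4]
    calc |(|a| ^ p * |1 + b / a| ^ p - |a| ^ p - |a| ^ p * (p * (b / a)))|
        = |a| ^ p * |(|1 + b / a| ^ p - 1 - p * (b / a))| := by
          rw [← abs_of_nonneg hap, ← abs_mul, abs_of_nonneg hap]
          congr 1
          ring
      _ ≤ |a| ^ p * (ε * |b / a| + C * |b / a| ^ p) := mul_le_mul_of_nonneg_left h1 hap
      _ = _ := by ring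

lemma abs_rpow_midpoint_lt {p : ℝ} (hp : 1 < p) {a b : ℝ} (hab : a ≠ b) :
    |(a + b) / 2| ^ p < (|a| ^ p + |b| ^ p) / 2 := by
  have hp0 : 0 < p := by linarith
  rcases eq_or_ne |a| |b| with h | h
  · rcases abs_eq_abs.1 h with h' | h'
    · exact absurd h' hab
    · have hb : b ≠ 0 := by
        rintro rfl
        simp [h'] at hab
      have : 0 < |b| ^ p := Real.rpow_pos_of_pos (abs_pos.2 hb) _
      rw [h', neg_add_cancel, zero_div, abs_zero, Real.zero_rpow hp0.ne', abs_neg]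
      linarith
  · have h1 := (strictConvexOn_rpow hp).2 (abs_nonneg a) (abs_nonneg b) h
      (show (0 : ℝ) < 1 / 2 by norm_num) (show (0 : ℝ) < 1 / 2 by norm_num) (by norm_num)
    simp only [smul_eq_mul] at h1
    have h2 : |(a + b) / 2| ≤ 1 / 2 * |a| + 1 / 2 * |b| := by
      rw [abs_div, abs_of_pos (show (0 : ℝ) < 2 by norm_num)]
      linarith [abs_add_le a b]
    have h3 := Real.rpow_le_rpow (abs_nonneg _) h2 hp0.le
    linarith

/-- Quantitative strict convexity of `|x|^p`; it yields the uniform convexity of `L^p` for all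
`p > 1` at once. By homogeneity it suffices to look at the unit sphere of the plane, where the
convexity gap is bounded below away from the diagonal, by compactness. -/
lemma exists_abs_sub_rpow_le {p ε : ℝ} (hp : 1 < p) (hε : 0 < ε) :
    ∃ C, 0 ≤ C ∧ ∀ a b : ℝ, |a - b| ^ p
      ≤ ε * (|a| ^ p + |b| ^ p) + C * ((|a| ^ p + |b| ^ p) / 2 - |(a + b) / 2| ^ p) := by
  have hp0 : 0 < p := by linarith
  have hgap : ∀ a b : ℝ, 0 ≤ (|a| ^ p + |b| ^ p) / 2 - |(a + b) / 2| ^ p := by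
    intro a b
    rcases eq_or_ne a b with rfl | hab
    · simp
    · exact (sub_pos.2 (abs_rpow_midpoint_lt hp hab)).le
  let gap : ℝ × ℝ → ℝ := fun x => (|x.1| ^ p + |x.2| ^ p) / 2 - |(x.1 + x.2) / 2| ^ p
  have habs : ∀ g : ℝ × ℝ → ℝ, Continuous g → Continuous fun x => |g x| ^ p := fun g hg =>
    hg.abs.rpow_const fun _ => Or.inr hp0.le
  have hgc : Continuous gap :=
    (((habs _ continuous_fst).add (habs _ continuous_snd)).div_const 2).sub
      (habs _ ((continuous_fst.add continuous_snd).div_const 2))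
  -- Where the inequality fails for `C = 0`, on the unit sphere.
  let K : Set (ℝ × ℝ) := Metric.sphere 0 1 ∩
    {x | ε * (|x.1| ^ p + |x.2| ^ p) ≤ |x.1 - x.2| ^ p}
  have hK : IsCompact K := (isCompact_sphere _ _).inter_right
    (isClosed_le (continuous_const.mul ((habs _ continuous_fst).add (habs _ continuous_snd)))
      (habs _ (continuous_fst.sub continuous_snd)))
  have hKpos : ∀ x ∈ K, 0 < gap x := by
    rintro ⟨a, b⟩ ⟨h1, h2⟩
    refine sub_pos.2 (abs_rpow_midpoint_lt hp ?_)
    rintro (rfl : a = b)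
    have h1' : |a| = 1 := by simpa using h1
    simp only [mem_ofPred_eq, h1', sub_self, abs_zero, Real.zero_rpow hp0.ne', Real.one_rpow] at h2
    linarith
  obtain ⟨m, hm, hmK⟩ : ∃ m, 0 < m ∧ ∀ x ∈ K, m ≤ gap x := by
    rcases K.eq_empty_or_nonempty with h | h
    · exact ⟨1, one_pos, by simp [h]⟩
    · obtain ⟨x₀, hx₀, hmin⟩ := hK.exists_isMinOn h hgc.continuousOn
      exact ⟨gap x₀, hKpos x₀ hx₀, fun x hx => hmin hx⟩
  refine ⟨2 ^ p / m, by positivity, ?_⟩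
  have hsph : ∀ a b : ℝ, ‖(a, b)‖ = 1 → |a - b| ^ p
      ≤ ε * (|a| ^ p + |b| ^ p) + 2 ^ p / m * ((|a| ^ p + |b| ^ p) / 2 - |(a + b) / 2| ^ p) := by
    intro a b hab
    have hC : 0 ≤ 2 ^ p / m * ((|a| ^ p + |b| ^ p) / 2 - |(a + b) / 2| ^ p) :=
      mul_nonneg (by positivity) (hgap a b)
    rcases le_or_gt (ε * (|a| ^ p + |b| ^ p)) (|a - b| ^ p) with h | h
    · have h1 : m ≤ (|a| ^ p + |b| ^ p) / 2 - |(a + b) / 2| ^ p :=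
        hmK (a, b) ⟨by simpa using hab, h⟩
      have ha : |a| ≤ 1 := hab ▸ norm_fst_le (a, b)
      have hb : |b| ≤ 1 := hab ▸ norm_snd_le (a, b)
      have h2 : |a - b| ^ p ≤ 2 ^ p :=
        Real.rpow_le_rpow (abs_nonneg _) (by linarith [abs_sub a b]) hp0.le
      have h3 : (2 : ℝ) ^ p = 2 ^ p / m * m := by field_simp
      have h4 : 2 ^ p / m * m ≤ 2 ^ p / m * ((|a| ^ p + |b| ^ p) / 2 - |(a + b) / 2| ^ p) :=
        mul_le_mul_of_nonneg_left h1 (by positivity)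
      have h5 : 0 ≤ ε * (|a| ^ p + |b| ^ p) := by positivity
      linarith
    · linarith
  intro a b
  rcases eq_or_ne ‖(a, b)‖ 0 with h0 | h0
  · have : (a, b) = 0 := norm_eq_zero.1 h0
    obtain ⟨rfl, rfl⟩ : a = 0 ∧ b = 0 := by simpa using this
    simp [Real.zero_rpow hp0.ne']
  · set s := ‖(a, b)‖ with hs
    have hs0 : 0 < s := lt_of_le_of_ne (norm_nonneg _) h0.symm
    have h1 := hsph (a / s) (b / s) (by
      have : (a / s, b / s) = s⁻¹ • (a, b) := by
        ext <;> simp [div_eq_inv_mul]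
      rw [this, norm_smul, ← hs, norm_inv, Real.norm_of_nonneg hs0.le, inv_mul_cancel₀ h0])
    have hsp : 0 < s ^ p := Real.rpow_pos_of_pos hs0 _
    have hdiv : ∀ x : ℝ, |x / s| ^ p = |x| ^ p / s ^ p := by
      intro x
      rw [abs_div, abs_of_pos hs0, Real.div_rpow (abs_nonneg _) hs0.le]
    rw [← sub_div, ← add_div, div_right_comm (a + b), hdiv, hdiv, hdiv, hdiv] at h1
    have h2 := mul_le_mul_of_nonneg_left h1 hsp.le
    calc |a - b| ^ p = s ^ p * (|a - b| ^ p / s ^ p) := by field_simp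
      _ ≤ _ := h2
      _ = _ := by field_simp

end Lebesgue

/-! ### Differentiability and uniform convexity of the norm of `L^p` -/

section LebesgueNorm

variable {X : Type*} [MeasurableSpace X] {μ : Measure X} {p : ℝ} [hp : Fact (1 < p)]

lemma integrable_abs_rpow_Lp (w : Lp ℝ (ENNReal.ofReal p) μ) :
    Integrable (fun x => |w x| ^ p) μ := by
  have hp0 : 0 < p := one_pos.trans hp.out
  have := (Lp.memLp w).integrable_norm_rpow (by simpa using hp0) ENNReal.ofReal_ne_top
  rwa [ENNReal.toReal_ofReal hp0.le] at this

lemma norm_rpow_eq_integral (w : Lp ℝ (ENNReal.ofReal p) μ) :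
    ‖w‖ ^ p = ∫ x, |w x| ^ p ∂μ := by
  have hp0 : 0 < p := one_pos.trans hp.out
  have h0 : 0 ≤ ∫ x, |w x| ^ p ∂μ := integral_nonneg fun x => by positivity
  rw [Lp.norm_def, (Lp.memLp w).eLpNorm_eq_integral_rpow_norm (by simpa using hp0)
    ENNReal.ofReal_ne_top, ENNReal.toReal_ofReal hp0.le]
  simp only [Real.norm_eq_abs]
  rw [ENNReal.toReal_ofReal (by positivity), Real.rpow_inv_rpow h0 hp0.ne']

/-- Young's inequality in a form that avoids conjugate exponents. Taking `l` to be the norm of `b`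
in `L^p` turns it into a substitute for Hölder's inequality. -/
lemma abs_mul_rpow_le {l : ℝ} (hl : 0 < l) (a b : ℝ) :
    |b| * |a| ^ (p - 1) ≤ l * ((|b| / l) ^ p + |a| ^ p) := by
  have hp1 := hp.out
  have hy : 0 ≤ |b| / l := by positivity
  set y := |b| / l with hy'
  have hb : |b| = l * y := by
    rw [hy']
    field_simp
  rw [hb, mul_assoc]
  refine mul_le_mul_of_nonneg_left ?_ hl.le
  have hsplit : ∀ x : ℝ, 0 ≤ x → x * x ^ (p - 1) = x ^ p := by
    intro x hx
    rw [← Real.rpow_one_add' hx (by linarith)]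
    congr 1
    ring
  rcases le_total y |a| with h | h
  · have h1 : y * |a| ^ (p - 1) ≤ |a| * |a| ^ (p - 1) :=
      mul_le_mul_of_nonneg_right h (by positivity)
    rw [hsplit _ (abs_nonneg _)] at h1
    have : 0 ≤ y ^ p := by positivity
    linarith
  · have h1 : y * |a| ^ (p - 1) ≤ y * y ^ (p - 1) :=
      mul_le_mul_of_nonneg_left (Real.rpow_le_rpow (abs_nonneg _) h (by linarith)) hy
    rw [hsplit _ hy] at h1
    have : 0 ≤ |a| ^ p := by positivity
    linarith

lemma integrable_abs_mul_rpow (w h : Lp ℝ (ENNReal.ofReal p) μ) :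
    Integrable (fun x => |h x| * |w x| ^ (p - 1)) μ := by
  refine ((integrable_abs_rpow_Lp h).add (integrable_abs_rpow_Lp w)).mono' ?_
    (Eventually.of_forall fun x => ?_)
  · exact (Lp.aestronglyMeasurable h).norm.mul
      (((Lp.aestronglyMeasurable w).norm.aemeasurable.pow_const _).aestronglyMeasurable)
  · rw [Real.norm_of_nonneg (by positivity)]
    simpa using abs_mul_rpow_le (p := p) one_pos (w x) (h x)

lemma integral_abs_mul_rpow_le (w h : Lp ℝ (ENNReal.ofReal p) μ) :
    ∫ x, |h x| * |w x| ^ (p - 1) ∂μ ≤ ‖h‖ * (1 + ‖w‖ ^ p) := by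
  have hp0 : 0 < p := one_pos.trans hp.out
  rcases eq_or_ne h 0 with rfl | h0
  · have : (fun x => |(0 : Lp ℝ (ENNReal.ofReal p) μ) x| * |w x| ^ (p - 1)) =ᵐ[μ] 0 := by
      filter_upwards [Lp.coeFn_zero ℝ (ENNReal.ofReal p) μ] with x hx
      rw [hx, Pi.zero_apply, abs_zero, zero_mul]
    rw [integral_congr_ae this]
    simp
  · have hl : 0 < ‖h‖ := norm_pos_iff.2 h0
    have hi : Integrable (fun x => ‖h‖ * ((|h x| / ‖h‖) ^ p + |w x| ^ p)) μ := by
      simp only [Real.div_rpow (abs_nonneg _) hl.le]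
      exact (((integrable_abs_rpow_Lp h).div_const _).add (integrable_abs_rpow_Lp w)).const_mul _
    refine (integral_mono (integrable_abs_mul_rpow w h) hi fun x =>
      abs_mul_rpow_le hl (w x) (h x)).trans_eq ?_
    simp only [Real.div_rpow (abs_nonneg _) hl.le]
    rw [integral_const_mul, integral_add ((integrable_abs_rpow_Lp h).div_const _)
      (integrable_abs_rpow_Lp w), integral_div, ← norm_rpow_eq_integral, ← norm_rpow_eq_integral,
      div_self (Real.rpow_pos_of_pos hl _).ne']

lemma abs_rpow_sub_two_mul (a b : ℝ) :
    |(p * |a| ^ (p - 2) * a * b)| = p * (|b| * |a| ^ (p - 1)) := by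
  have hp0 : 0 < p := one_pos.trans hp.out
  rcases eq_or_ne a 0 with rfl | ha
  · simp [Real.zero_rpow (sub_pos.2 hp.out).ne']
  · have ha' := abs_pos.2 ha
    rw [abs_mul, abs_mul, abs_mul, abs_of_pos hp0,
      abs_of_nonneg (by positivity : 0 ≤ |a| ^ (p - 2)),
      show p - 1 = (p - 2) + 1 by ring, Real.rpow_add ha', Real.rpow_one]
    ring

lemma integrable_rpow_sub_two_mul (w h : Lp ℝ (ENNReal.ofReal p) μ) :
    Integrable (fun x => p * |w x| ^ (p - 2) * w x * h x) μ := by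
  refine ((integrable_abs_mul_rpow w h).const_mul p).mono' ?_ (Eventually.of_forall fun x => ?_)
  · have hm := ((Lp.aestronglyMeasurable w).norm.aemeasurable.pow_const
      (p - 2)).aestronglyMeasurable
    exact ((hm.const_mul p).mul (Lp.aestronglyMeasurable w)).mul (Lp.aestronglyMeasurable h)
  · exact (abs_rpow_sub_two_mul (w x) (h x)).le

/-- The derivative `h ↦ p ∫ |w|^(p-2) w h` of `w ↦ ‖w‖^p` on `L^p`. -/
def normRpowDeriv (w : Lp ℝ (ENNReal.ofReal p) μ) : Lp ℝ (ENNReal.ofReal p) μ →L[ℝ] ℝ :=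
  LinearMap.mkContinuous
    { toFun := fun h => ∫ x, p * |w x| ^ (p - 2) * w x * h x ∂μ
      map_add' := fun g h => by
        rw [← integral_add (integrable_rpow_sub_two_mul w g) (integrable_rpow_sub_two_mul w h)]
        refine integral_congr_ae ?_
        filter_upwards [Lp.coeFn_add g h] with x hx
        rw [hx, Pi.add_apply, mul_add]
      map_smul' := fun c h => by
        rw [RingHom.id_apply, smul_eq_mul, ← integral_const_mul]
        refine integral_congr_ae ?_
        filter_upwards [Lp.coeFn_smul c h] with x hx
        rw [hx, Pi.smul_apply, smul_eq_mul]
        ring }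
    (p * (1 + ‖w‖ ^ p))
    (fun h => by
      have hp0 : 0 < p := one_pos.trans hp.out
      refine (norm_integral_le_integral_norm _).trans ?_
      simp only [Real.norm_eq_abs, abs_rpow_sub_two_mul]
      rw [integral_const_mul, mul_assoc, mul_comm (1 + _)]
      exact mul_le_mul_of_nonneg_left (integral_abs_mul_rpow_le w h) hp0.le)

lemma normRpowDeriv_apply (w h : Lp ℝ (ENNReal.ofReal p) μ) :
    normRpowDeriv w h = ∫ x, p * |w x| ^ (p - 2) * w x * h x ∂μ := rfl

lemma hasFDerivAt_norm_rpow_Lp (w : Lp ℝ (ENNReal.ofReal p) μ) :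
    HasFDerivAt (fun v : Lp ℝ (ENNReal.ofReal p) μ => ‖v‖ ^ p) (normRpowDeriv w) w := by
  have hp1 := hp.out
  have hp0 : 0 < p := one_pos.trans hp1
  rw [hasFDerivAt_iff_isLittleO_nhds_zero, Asymptotics.isLittleO_iff]
  intro c hc
  have hW : 0 < 1 + ‖w‖ ^ p := by positivity
  obtain ⟨C, hC0, hC⟩ := exists_abs_rpow_expansion hp1
    (show 0 < c / 2 / (1 + ‖w‖ ^ p) by positivity)
  have hlim : Tendsto (fun h : Lp ℝ (ENNReal.ofReal p) μ => C * ‖h‖ ^ (p - 1)) (𝓝 0) (𝓝 0) := by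
    have hcont : Continuous fun h : Lp ℝ (ENNReal.ofReal p) μ => C * ‖h‖ ^ (p - 1) :=
      continuous_const.mul (continuous_norm.rpow_const fun _ => Or.inr (by linarith))
    convert hcont.tendsto 0 using 2
    simp [Real.zero_rpow (sub_pos.2 hp1).ne']
  filter_upwards [hlim.eventually_lt_const (half_pos hc)] with h hh
  have i1 := integrable_abs_rpow_Lp (w + h)
  have i2 := integrable_abs_rpow_Lp w
  have i3 := integrable_rpow_sub_two_mul w h
  have i4 := (integrable_abs_mul_rpow w h).const_mul (c / 2 / (1 + ‖w‖ ^ p))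
  have i5 := (integrable_abs_rpow_Lp h).const_mul C
  have i6 : Integrable (fun x => |(w + h) x| ^ p - |w x| ^ p) μ := i1.sub i2
  rw [norm_rpow_eq_integral (w + h), norm_rpow_eq_integral w, normRpowDeriv_apply,
    ← integral_sub i1 i2, ← integral_sub i6 i3]
  have h1 : ‖∫ x, (|(w + h) x| ^ p - |w x| ^ p - p * |w x| ^ (p - 2) * w x * h x) ∂μ‖
      ≤ ∫ x, (c / 2 / (1 + ‖w‖ ^ p) * (|h x| * |w x| ^ (p - 1)) + C * |h x| ^ p) ∂μ := by
    refine norm_integral_le_of_norm_le (i4.add i5) ?_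
    filter_upwards [Lp.coeFn_add w h] with x hx
    rw [hx, Pi.add_apply]
    exact hC (w x) (h x)
  refine h1.trans ?_
  rw [integral_add i4 i5, integral_const_mul, integral_const_mul, ← norm_rpow_eq_integral]
  have h2 : c / 2 / (1 + ‖w‖ ^ p) * ∫ x, |h x| * |w x| ^ (p - 1) ∂μ ≤ c / 2 * ‖h‖ := by
    refine (mul_le_mul_of_nonneg_left (integral_abs_mul_rpow_le w h) (by positivity)).trans_eq ?_
    field_simp
  have h3 : C * ‖h‖ ^ p ≤ c / 2 * ‖h‖ := by
    have : ‖h‖ ^ p = ‖h‖ ^ (p - 1) * ‖h‖ := by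
      rw [← Real.rpow_add_one' (norm_nonneg _) (by linarith)]
      congr 1
      ring
    rw [this, ← mul_assoc]
    exact mul_le_mul_of_nonneg_right hh.le (norm_nonneg _)
  linarith

/-- Uniform convexity of `L^p`, `1 < p < ∞`. -/
lemma exists_norm_sub_rpow_le {ε : ℝ} (hε : 0 < ε) :
    ∃ C, 0 ≤ C ∧ ∀ v w : Lp ℝ (ENNReal.ofReal p) μ, ‖v - w‖ ^ p
      ≤ ε * (‖v‖ ^ p + ‖w‖ ^ p)
        + C * ((‖v‖ ^ p + ‖w‖ ^ p) / 2 - ‖(1 / 2 : ℝ) • (v + w)‖ ^ p) := by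
  obtain ⟨C, hC0, hC⟩ := exists_abs_sub_rpow_le hp.out hε
  refine ⟨C, hC0, fun v w => ?_⟩
  have i1 := integrable_abs_rpow_Lp v
  have i2 := integrable_abs_rpow_Lp w
  have i3 := integrable_abs_rpow_Lp ((1 / 2 : ℝ) • (v + w))
  have i0 : Integrable (fun x => |v x| ^ p + |w x| ^ p) μ := i1.add i2
  have i4 := i0.const_mul ε
  have i6 : Integrable (fun x => (|v x| ^ p + |w x| ^ p) / 2
      - |((1 / 2 : ℝ) • (v + w)) x| ^ p) μ := (i0.div_const 2).sub i3
  have i5 := i6.const_mul C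
  simp only [norm_rpow_eq_integral]
  rw [← integral_add i1 i2, ← integral_div, ← integral_sub (i0.div_const 2) i3,
    ← integral_const_mul, ← integral_const_mul]
  refine (integral_mono_ae (integrable_abs_rpow_Lp (v - w)) (i4.add i5) ?_).trans_eq
    (integral_add i4 i5)
  filter_upwards [Lp.coeFn_sub v w, Lp.coeFn_smul (1 / 2 : ℝ) (v + w), Lp.coeFn_add v w]
    with x h1 h2 h3
  have := hC (v x) (w x)
  simp only [Pi.add_apply, Pi.sub_apply, h1, h2, Pi.smul_apply, h3, smul_eq_mul]
  rwa [show 1 / 2 * (v x + w x) = (v x + w x) / 2 by ring]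

end LebesgueNorm

/-! ### The nonlinear term of the energy -/

section Nemytskii

variable {g : ℝ → ℝ → ℝ}

lemma continuous_primitive (hg : Continuous (Function.uncurry g)) :
    Continuous (Function.uncurry (primitive g)) :=
  intervalIntegral.continuous_parametric_primitive_of_continuous hg

lemma continuous_primitive_comp (hg : Continuous (Function.uncurry g))
    (h : BoundedContinuousFunction ℝ ℝ) : Continuous fun t => primitive g t (h t) :=
  (continuous_primitive hg).comp (continuous_id.prodMk h.continuous)

lemma integrableOn_primitive_comp (hg : Continuous (Function.uncurry g)) (T : ℝ)
    (h : BoundedContinuousFunction ℝ ℝ) :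
    IntegrableOn (fun t => primitive g t (h t)) (Icc 0 T) :=
  (continuous_primitive_comp hg h).continuousOn.integrableOn_Icc

/-- The functional `h ↦ ∫₀ᵀ G(t, h(t)) dt`, where `G` is the primitive of `g`. -/
def primitiveInt (g : ℝ → ℝ → ℝ) (T : ℝ) (h : BoundedContinuousFunction ℝ ℝ) : ℝ :=
  ∫ t in Icc 0 T, primitive g t (h t)

lemma integrableOn_comp_mul (hg : Continuous (Function.uncurry g)) (T : ℝ)
    (h k : BoundedContinuousFunction ℝ ℝ) :
    IntegrableOn (fun t => g t (h t) * k t) (Icc 0 T) :=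
  ((hg.comp (continuous_id.prodMk h.continuous)).mul k.continuous).continuousOn.integrableOn_Icc

/-- The derivative `k ↦ ∫₀ᵀ g(t, h(t)) k(t) dt` of `primitiveInt g T` at `h`. -/
def primitiveIntDeriv (hg : Continuous (Function.uncurry g)) (T : ℝ)
    (h : BoundedContinuousFunction ℝ ℝ) : BoundedContinuousFunction ℝ ℝ →L[ℝ] ℝ :=
  LinearMap.mkContinuous
    { toFun := fun k => ∫ t in Icc 0 T, g t (h t) * k t
      map_add' := fun k l => by
        rw [← integral_add (integrableOn_comp_mul hg T h k) (integrableOn_comp_mul hg T h l)]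
        simp only [BoundedContinuousFunction.coe_add, Pi.add_apply, mul_add]
      map_smul' := fun c k => by
        rw [RingHom.id_apply, smul_eq_mul, ← integral_const_mul]
        simp only [BoundedContinuousFunction.coe_smul, smul_eq_mul, mul_left_comm] }
    (∫ t in Icc 0 T, |g t (h t)|)
    (fun k => by
      have hi : IntegrableOn (fun t => |g t (h t)|) (Icc 0 T) :=
        (hg.comp (continuous_id.prodMk h.continuous)).abs.continuousOn.integrableOn_Icc
      rw [← integral_mul_const]
      refine norm_integral_le_of_norm_le (hi.mul_const _) (Eventually.of_forall fun t => ?_)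
      rw [norm_mul]
      exact mul_le_mul_of_nonneg_left (k.norm_coe_le_norm t) (abs_nonneg _))

lemma primitiveIntDeriv_apply (hg : Continuous (Function.uncurry g)) (T : ℝ)
    (h k : BoundedContinuousFunction ℝ ℝ) :
    primitiveIntDeriv hg T h k = ∫ t in Icc 0 T, g t (h t) * k t := rfl

lemma primitive_sub_sub (hg : Continuous (Function.uncurry g)) (t x y : ℝ) :
    primitive g t (x + y) - primitive g t x - g t x * y
      = ∫ s in x..(x + y), (g t s - g t x) := by
  have hi : ∀ a b, IntervalIntegrable (g t) volume a b := fun a b =>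
    (hg.comp (continuous_const.prodMk continuous_id)).intervalIntegrable a b
  rw [intervalIntegral.integral_sub (hi _ _) intervalIntegrable_const,
    intervalIntegral.integral_const, primitive, primitive,
    intervalIntegral.integral_interval_sub_left (hi _ _) (hi _ _), smul_eq_mul]
  ring

lemma hasFDerivAt_primitiveInt (hg : Continuous (Function.uncurry g)) (T : ℝ)
    (h : BoundedContinuousFunction ℝ ℝ) :
    HasFDerivAt (primitiveInt g T) (primitiveIntDeriv hg T h) h := by
  rw [hasFDerivAt_iff_isLittleO_nhds_zero, Asymptotics.isLittleO_iff]
  intro c hc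
  set V := volume.real (Icc 0 T) with hV
  have hV0 : 0 ≤ V := measureReal_nonneg
  set M := ‖h‖ + 1
  have hK : IsCompact (Icc (0 : ℝ) T ×ˢ Icc (-M) M) := isCompact_Icc.prod isCompact_Icc
  have hu := hK.uniformContinuousOn_of_continuous hg.continuousOn
  obtain ⟨δ, hδ, hu⟩ := Metric.uniformContinuousOn_iff.1 hu (c / (V + 1)) (by positivity)
  have hball : ∀ᶠ k : BoundedContinuousFunction ℝ ℝ in 𝓝 0, ‖k‖ < min δ 1 := by
    filter_upwards [Metric.ball_mem_nhds (0 : BoundedContinuousFunction ℝ ℝ)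
      (lt_min hδ one_pos)] with k hk
    simpa using hk
  filter_upwards [hball] with k hk
  have i1 := integrableOn_primitive_comp hg T (h + k)
  have i2 := integrableOn_primitive_comp hg T h
  have i3 := integrableOn_comp_mul hg T h k
  have i4 : IntegrableOn (fun t => primitive g t ((h + k) t) - primitive g t (h t)) (Icc 0 T) :=
    i1.sub i2
  rw [primitiveIntDeriv_apply, primitiveInt, primitiveInt, ← integral_sub i1 i2,
    ← integral_sub i4 i3]
  have hpt : ∀ t ∈ Icc 0 T, ‖primitive g t ((h + k) t) - primitive g t (h t) - g t (h t) * k t‖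
      ≤ c / (V + 1) * ‖k‖ := by
    intro t ht
    have hht := h.norm_coe_le_norm t
    have hkt := k.norm_coe_le_norm t
    rw [BoundedContinuousFunction.coe_add, Pi.add_apply, primitive_sub_sub hg]
    refine (intervalIntegral.norm_integral_le_of_norm_le_const (C := c / (V + 1))
      fun s hs => ?_).trans ?_
    · have hs' : |s - h t| ≤ |k t| := by
        have := abs_sub_left_of_mem_uIcc (uIoc_subset_uIcc hs)
        simpa using this
      have hk1 : ‖k‖ < 1 := hk.trans_le (min_le_right _ _)
      have hkd : ‖k‖ < δ := hk.trans_le (min_le_left _ _)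
      rw [Real.norm_eq_abs] at hht hkt
      have hsM : s ∈ Icc (-M) M := by
        have h1 := abs_le.1 hs'
        have h2 := abs_le.1 hht
        constructor <;> simp only [M] <;> linarith [h1.1, h1.2, h2.1, h2.2]
      have hhM : h t ∈ Icc (-M) M := by
        have h2 := abs_le.1 hht
        constructor <;> simp only [M] <;> linarith [h2.1, h2.2]
      have := hu (t, s) ⟨ht, hsM⟩ (t, h t) ⟨ht, hhM⟩ (by
        rw [Prod.dist_eq, dist_self, Real.dist_eq]
        exact max_lt hδ (by linarith))
      exact this.le
    · rw [add_sub_cancel_left]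
      exact mul_le_mul_of_nonneg_left hkt (by positivity)
  refine (norm_setIntegral_le_of_norm_le_const measure_Icc_lt_top hpt).trans ?_
  rw [← hV, div_mul_eq_mul_div, div_mul_eq_mul_div, div_le_iff₀ (by positivity)]
  nlinarith [mul_nonneg hc.le (norm_nonneg k)]

/-- A growth bound for `g` integrates to a growth bound for its primitive. -/
lemma abs_primitive_le {r A t : ℝ} (hr : 1 < r)
    (hb : ∀ x, |g t x| ≤ r * A * |x| ^ (r - 1)) (x : ℝ) :
    |primitive g t x| ≤ A * |x| ^ r := by
  have hnn : ∀ x, 0 ≤ x → ∀ k : ℝ → ℝ, (∀ s, |k s| ≤ r * A * |s| ^ (r - 1)) →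
      |∫ s in (0 : ℝ)..x, k s| ≤ A * |x| ^ r := by
    intro x hx k hk
    have hi : IntervalIntegrable (fun s : ℝ => r * A * s ^ (r - 1)) volume 0 x :=
      (intervalIntegral.intervalIntegrable_rpow' (by linarith)).const_mul _
    have h1 := intervalIntegral.norm_integral_le_of_norm_le hx (f := k)
      (g := fun s : ℝ => r * A * s ^ (r - 1))
      (Eventually.of_forall fun s hs => by
        have := hk s
        rwa [abs_of_pos hs.1] at this) hi
    refine h1.trans_eq ?_
    rw [intervalIntegral.integral_const_mul, integral_rpow (Or.inl (by linarith)),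
      sub_add_cancel, Real.zero_rpow (by linarith), abs_of_nonneg hx]
    field_simp
    ring
  rcases le_total 0 x with hx | hx
  · exact hnn x hx _ hb
  · have h1 := hnn (-x) (by linarith) (fun s => g t (-s)) (fun s => by simpa using hb (-s))
    rw [intervalIntegral.integral_comp_neg, neg_neg, neg_zero, intervalIntegral.integral_symm,
      abs_neg, abs_neg] at h1
    exact h1

lemma primitiveInt_le {r T : ℝ} (hr : 1 < r) (hg : Continuous (Function.uncurry g)) {a : ℝ → ℝ}
    (ha : IntegrableOn a (Icc 0 T)) (ha0 : ∀ t ∈ Icc 0 T, 0 ≤ a t)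
    (hb : ∀ t ∈ Icc 0 T, ∀ x, |g t x| ≤ r * a t * |x| ^ (r - 1))
    (h : BoundedContinuousFunction ℝ ℝ) :
    primitiveInt g T h ≤ (∫ t in Icc 0 T, a t) * ‖h‖ ^ r := by
  rw [primitiveInt, ← integral_mul_const]
  refine setIntegral_mono_on (integrableOn_primitive_comp hg T h) (ha.mul_const _)
    measurableSet_Icc fun t ht => ?_
  refine (le_abs_self _).trans ((abs_primitive_le hr (hb t ht) _).trans ?_)
  exact mul_le_mul_of_nonneg_left (Real.rpow_le_rpow (abs_nonneg _) (h.norm_coe_le_norm t)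
    (by linarith)) (ha0 t ht)

end Nemytskii

/-! ### The energy functional -/

section Energy

/-- A continuous extension to the plane of a function that is continuous on the strip
`[0, T] × ℝ`. -/
def stripExtend (T : ℝ) (f : ℝ → ℝ → ℝ) (t x : ℝ) : ℝ := f (clamp T t) x

lemma continuous_stripExtend {T : ℝ} (hT : 0 < T) {f : ℝ → ℝ → ℝ}
    (hf : ContinuousOn (Function.uncurry f) (Icc (0 : ℝ) T ×ˢ univ)) :
    Continuous (Function.uncurry (stripExtend T f)) :=
  hf.comp_continuous (f := fun x : ℝ × ℝ => (clamp T x.1, x.2))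
    (((continuous_clamp T).comp continuous_fst).prodMk continuous_snd)
    fun x => ⟨clamp_mem hT x.1, mem_univ _⟩

lemma stripExtend_of_mem {T t : ℝ} (ht : t ∈ Icc 0 T) (f : ℝ → ℝ → ℝ) :
    stripExtend T f t = f t := by
  funext x
  rw [stripExtend, clamp_of_mem ht]

lemma primitive_stripExtend {T t : ℝ} (ht : t ∈ Icc 0 T) (f : ℝ → ℝ → ℝ) (x : ℝ) :
    primitive (stripExtend T f) t x = primitive f t x := by
  rw [primitive, primitive, stripExtend_of_mem ht]

variable {p α T : ℝ} [hp : Fact (1 < p)] {f : ℝ → ℝ → ℝ}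

lemma energyDensity_ae_eq (hα : α ∈ Ioc (1 / p) 1) (f : ℝ → ℝ → ℝ) (u : FracSpace α p T) :
    energyDensity f u =ᵐ[volume.restrict (Icc 0 T)] fun t =>
      1 / p * |(u : LpPair p T).snd t| ^ p
        - primitive (stripExtend T f) t (embed hα.1 T u t) := by
  filter_upwards [leftRLDeriv_toLpT_ae_eq hα u, toLpT_ae_eq_embed hα u,
    ae_restrict_mem measurableSet_Icc] with t h1 h2 ht
  rw [energyDensity, h1, h2, primitive_stripExtend ht]

lemma integrableOn_energyDensity (hT : 0 < T) (hα : α ∈ Ioc (1 / p) 1)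
    (hf : ContinuousOn (Function.uncurry f) (Icc (0 : ℝ) T ×ˢ univ)) (u : FracSpace α p T) :
    IntegrableOn (energyDensity f u) (Icc 0 T) :=
  (((integrable_abs_rpow_Lp _).const_mul _).sub (integrableOn_primitive_comp
    (continuous_stripExtend hT hf) T (embed hα.1 T u))).congr (energyDensity_ae_eq hα f u).symm

lemma energy_eq (hT : 0 < T) (hα : α ∈ Ioc (1 / p) 1)
    (hf : ContinuousOn (Function.uncurry f) (Icc (0 : ℝ) T ×ˢ univ)) (u : FracSpace α p T) :
    energy f u = 1 / p * ‖(u : LpPair p T).snd‖ ^ p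
      - primitiveInt (stripExtend T f) T (embed hα.1 T u) := by
  rw [energy, integral_congr_ae (energyDensity_ae_eq hα f u),
    integral_sub ((integrable_abs_rpow_Lp _).const_mul _)
      (integrableOn_primitive_comp (continuous_stripExtend hT hf) T (embed hα.1 T u)),
    integral_const_mul, ← norm_rpow_eq_integral]
  rfl

lemma differentiable_energy (hT : 0 < T) (hα : α ∈ Ioc (1 / p) 1)
    (hf : ContinuousOn (Function.uncurry f) (Icc (0 : ℝ) T ×ˢ univ)) :
    Differentiable ℝ (energy f : FracSpace α p T → ℝ) := by
  intro u
  have h1 := (hasFDerivAt_norm_rpow_Lp (u : LpPair p T).snd).comp u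
    (sndL p T ∘L (FracSpace α p T).subtypeL).hasFDerivAt
  have h2 := (hasFDerivAt_primitiveInt (continuous_stripExtend hT hf) T (embed hα.1 T u)).comp u
    (embed hα.1 T).hasFDerivAt
  have h3 := (h1.const_mul (1 / p)).sub h2
  have h4 : (energy f : FracSpace α p T → ℝ) = _ := funext (energy_eq hT hα hf)
  rw [h4]
  exact h3.differentiableAt

/-- A lower bound for the energy in terms of the norm of the fractional derivative. -/
lemma exists_le_energy (hT : 0 < T) (hα : α ∈ Ioc (1 / p) 1)
    (hf : ContinuousOn (Function.uncurry f) (Icc (0 : ℝ) T ×ˢ univ)) {r : ℝ} (hr : 1 < r)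
    {a : ℝ → ℝ} (ha : IntegrableOn a (Icc 0 T)) (ha0 : ∀ t ∈ Icc 0 T, 0 ≤ a t)
    (hb : ∀ t ∈ Icc 0 T, ∀ x, |f t x| ≤ r * a t * |x| ^ (r - 1)) :
    ∃ B, 0 ≤ B ∧ ∀ u : FracSpace α p T,
      1 / p * ‖(u : LpPair p T).snd‖ ^ p - B * ‖(u : LpPair p T).snd‖ ^ r ≤ energy f u := by
  have hA : 0 ≤ ∫ t in Icc 0 T, a t := setIntegral_nonneg measurableSet_Icc ha0
  refine ⟨(∫ t in Icc 0 T, a t) * ‖fracInt (p := p) hα.1 T‖ ^ r, by positivity, fun u => ?_⟩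
  rw [energy_eq hT hα hf u]
  have h1 := primitiveInt_le hr (continuous_stripExtend hT hf) ha ha0
    (fun t ht x => by rw [stripExtend_of_mem ht]; exact hb t ht x) (embed hα.1 T u)
  have h2 : ‖embed hα.1 T u‖ ^ r
      ≤ ‖fracInt (p := p) hα.1 T‖ ^ r * ‖(u : LpPair p T).snd‖ ^ r := by
    exact (Real.rpow_le_rpow (norm_nonneg _) ((fracInt hα.1 T).le_opNorm _)
      (by linarith)).trans_eq (Real.mul_rpow (norm_nonneg _) (norm_nonneg _))
  have h3 := mul_le_mul_of_nonneg_left h2 hA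
  rw [← mul_assoc] at h3
  linarith

lemma tendsto_rpow_sub_rpow {r q : ℝ} (hr : 0 < r) (hrq : r < q) (hq : 0 < q) (B : ℝ) :
    Tendsto (fun x : ℝ => 1 / q * x ^ q - B * x ^ r) atTop atTop := by
  have h1 : Tendsto (fun x : ℝ => x ^ r * (1 / q * x ^ (q - r) - B)) atTop atTop :=
    (tendsto_rpow_atTop hr).atTop_mul_atTop₀ (tendsto_atTop_add_const_right _ _
      ((tendsto_rpow_atTop (sub_pos.2 hrq)).const_mul_atTop (by positivity)))
  refine h1.congr' ?_
  filter_upwards [eventually_gt_atTop 0] with x hx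
  have : x ^ q = x ^ r * x ^ (q - r) := by
    rw [← Real.rpow_add hx]
    congr 1
    ring
  rw [this]
  ring

/-- On `E_0^{α,p}` the norm of the fractional derivative is coercive. -/
lemma tendsto_norm_snd_cobounded (hα : α ∈ Ioc (1 / p) 1) :
    Tendsto (fun u : FracSpace α p T => ‖(u : LpPair p T).snd‖)
      (Bornology.cobounded (FracSpace α p T)) atTop := by
  have hC : 0 < ‖potential (p := p) hα.1 T‖ + 1 := by positivity
  refine tendsto_atTop_mono (fun u => ?_)
    ((tendsto_norm_cobounded_atTop (E := FracSpace α p T)).atTop_div_const hC)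
  rw [div_le_iff₀ hC]
  have h1 := (potential hα.1 T).le_opNorm (u : LpPair p T).snd
  rw [potential_snd_eq hα u] at h1
  have h2 : ‖u‖ = ‖(u : LpPair p T)‖ := rfl
  rw [h2]
  nlinarith [norm_nonneg (u : LpPair p T).snd]

/-- The existence of a minimizer. By compactness of `I^α`, a subsequence of a minimizing sequence
converges uniformly; since midpoints do not have a smaller energy, uniform convexity of `L^p` shows
that the fractional derivatives form a Cauchy sequence, so no weak compactness is needed. -/
lemma exists_forall_energy_le (hT : 0 < T) (hα : α ∈ Ioc (1 / p) 1)
    (hf : ContinuousOn (Function.uncurry f) (Icc (0 : ℝ) T ×ˢ univ))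
    (hbdd : BddBelow (range (energy f : FracSpace α p T → ℝ)))
    (hcoer : Tendsto (energy f : FracSpace α p T → ℝ)
      (Bornology.cobounded (FracSpace α p T)) atTop) :
    ∃ u : FracSpace α p T, ∀ v : FracSpace α p T, energy f u ≤ energy f v := by
  have hp0 : 0 < p := one_pos.trans hp.out
  set G := primitiveInt (stripExtend T f) T with hG
  have hGc : Continuous G := continuous_iff_continuousAt.2 fun h =>
    (hasFDerivAt_primitiveInt (continuous_stripExtend hT hf) T h).continuousAt
  have hJ := energy_eq (f := f) hT hα hf
  set m := sInf (range (energy f : FracSpace α p T → ℝ)) with hm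
  have hmle : ∀ v : FracSpace α p T, m ≤ energy f v := fun v => csInf_le hbdd (mem_range_self v)
  have hseq : ∀ n : ℕ, ∃ u : FracSpace α p T, energy f u < m + 1 / ((n : ℝ) + 1) := by
    intro n
    obtain ⟨_, ⟨u, rfl⟩, hu⟩ := exists_lt_of_csInf_lt (range_nonempty _)
      (show m < m + 1 / ((n : ℝ) + 1) by linarith [Nat.one_div_pos_of_nat (α := ℝ) (n := n)])
    exact ⟨u, hu⟩
  choose u hu using hseq
  obtain ⟨R, hR⟩ : ∃ R, ∀ n, ‖((u n : FracSpace α p T) : LpPair p T).snd‖ ≤ R := by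
    have hb : Bornology.IsBounded {v : FracSpace α p T | energy f v < m + 1} := by
      rw [← Bornology.isCobounded_compl_iff]
      filter_upwards [hcoer.eventually_ge_atTop (m + 1)] with v hv
      simpa using hv
    obtain ⟨R, hR⟩ := hb.exists_norm_le
    refine ⟨‖sndL p T‖ * R, fun n => ((sndL p T).le_opNorm _).trans ?_⟩
    refine mul_le_mul_of_nonneg_left (hR (u n) ?_) (norm_nonneg _)
    refine (hu n).trans_le (add_le_add_right ?_ m)
    rw [div_le_one (by positivity)]
    linarith [Nat.cast_nonneg (α := ℝ) n]
  have hulim : Tendsto (fun n => energy f (u n)) atTop (𝓝 m) := by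
    refine tendsto_of_tendsto_of_tendsto_of_le_of_le tendsto_const_nhds ?_
      (fun n => hmle (u n)) (fun n => (hu n).le)
    simpa using (tendsto_const_nhds (x := m)).add (tendsto_one_div_add_atTop_nhds_zero_nat (𝕜 := ℝ))
  obtain ⟨K, hK, hKm⟩ := exists_isCompact_fracInt_image (p := p) hα.1 hT R
  obtain ⟨h, -, φ, hφ, hlim⟩ := hK.tendsto_subseq (x := fun n => embed hα.1 T (u n))
    fun n => hKm _ (hR n)
  set v := fun n => u (φ n) with hv
  set w := fun n => ((v n : FracSpace α p T) : LpPair p T).snd with hw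
  have hvlim : Tendsto (fun n => energy f (v n)) atTop (𝓝 m) := hulim.comp hφ.tendsto_atTop
  have hlim' : Tendsto (fun n => embed hα.1 T (v n)) atTop (𝓝 h) := hlim
  have hN : Tendsto (fun n => ‖w n‖ ^ p) atTop (𝓝 (p * (m + G h))) := by
    have := (hvlim.add ((hGc.tendsto h).comp hlim')).const_mul p
    refine this.congr fun n => ?_
    have h1 : energy f (v n) + G (embed hα.1 T (v n)) = 1 / p * ‖w n‖ ^ p := by
      rw [hJ (v n)]
      exact sub_add_cancel _ _
    rw [Function.comp_apply, h1]
    field_simp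
  have hmid : ∀ n k, p * (m + G ((1 / 2 : ℝ) • (embed hα.1 T (v n) + embed hα.1 T (v k))))
      ≤ ‖(1 / 2 : ℝ) • (w n + w k)‖ ^ p := by
    intro n k
    have h1 := hmle ((1 / 2 : ℝ) • (v n + v k))
    rw [hJ, map_smul, map_add] at h1
    have h2 : (((1 / 2 : ℝ) • (v n + v k) : FracSpace α p T) : LpPair p T).snd
        = (1 / 2 : ℝ) • (w n + w k) := rfl
    rw [h2] at h1
    have h3 : p * (1 / p * ‖(1 / 2 : ℝ) • (w n + w k)‖ ^ p)
        = ‖(1 / 2 : ℝ) • (w n + w k)‖ ^ p := by field_simp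
    rw [← h3]
    exact mul_le_mul_of_nonneg_left (by linarith) hp0.le
  have hgap : Tendsto (fun x : ℕ × ℕ => (‖w x.1‖ ^ p + ‖w x.2‖ ^ p) / 2
      - p * (m + G ((1 / 2 : ℝ) • (embed hα.1 T (v x.1) + embed hα.1 T (v x.2)))))
      atTop (𝓝 0) := by
    rw [← prod_atTop_atTop_eq]
    have t1 : Tendsto Prod.fst (atTop ×ˢ atTop : Filter (ℕ × ℕ)) atTop := tendsto_fst
    have t2 : Tendsto Prod.snd (atTop ×ˢ atTop : Filter (ℕ × ℕ)) atTop := tendsto_snd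
    have e1 := ((hN.comp t1).add (hN.comp t2)).div_const 2
    have e2 := ((hlim'.comp t1).add (hlim'.comp t2)).const_smul (1 / 2 : ℝ)
    have e3 := (((hGc.tendsto _).comp e2).const_add m).const_mul p
    have e4 := e1.sub e3
    have e5 : (1 / 2 : ℝ) • (h + h) = h := by
      rw [← two_smul ℝ h, smul_smul]
      norm_num
    rw [e5, add_self_div_two, sub_self] at e4
    exact e4
  have hcauchy : CauchySeq w := by
    rw [cauchySeq_iff_tendsto_dist_atTop_0, Metric.tendsto_nhds]
    intro e he
    have hR0 : 0 ≤ R := (norm_nonneg _).trans (hR 0)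
    have hep : 0 < e ^ p := Real.rpow_pos_of_pos he _
    have hRp : 0 ≤ R ^ p := Real.rpow_nonneg hR0 _
    -- The norms `‖w n‖` are at most `R`, so this `ε` makes the first term at most `e ^ p / 2`.
    obtain ⟨C, hC0, hC⟩ := exists_norm_sub_rpow_le (p := p)
      (μ := volume.restrict (Icc (0 : ℝ) T))
      (show 0 < e ^ p / (4 * R ^ p + 4) by positivity)
    have h0 := hgap.const_mul C
    rw [mul_zero] at h0
    filter_upwards [h0.eventually_lt_const (half_pos hep)] with x hx
    rw [Real.dist_0_eq_abs, abs_of_nonneg dist_nonneg, dist_eq_norm,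
      ← Real.rpow_lt_rpow_iff (norm_nonneg _) he.le hp0]
    have hw1 : ‖w x.1‖ ^ p ≤ R ^ p := Real.rpow_le_rpow (norm_nonneg _) (hR _) hp0.le
    have hw2 : ‖w x.2‖ ^ p ≤ R ^ p := Real.rpow_le_rpow (norm_nonneg _) (hR _) hp0.le
    have b1 : e ^ p / (4 * R ^ p + 4) * (‖w x.1‖ ^ p + ‖w x.2‖ ^ p) ≤ e ^ p / 2 := by
      rw [div_mul_eq_mul_div, div_le_div_iff₀ (by positivity) (by norm_num)]
      nlinarith
    have b2 := mul_le_mul_of_nonneg_left (sub_le_sub_left (hmid x.1 x.2)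
      ((‖w x.1‖ ^ p + ‖w x.2‖ ^ p) / 2)) hC0
    linarith [hC (w x.1) (w x.2)]
  obtain ⟨w₀, hw₀⟩ := cauchySeq_tendsto_of_complete hcauchy
  have hpot : Tendsto (fun n => ((v n : FracSpace α p T) : LpPair p T)) atTop
      (𝓝 (potential hα.1 T w₀)) := by
    refine (((potential hα.1 T).continuous.tendsto w₀).comp hw₀).congr fun n => ?_
    exact potential_snd_eq hα (v n)
  have hmem : potential hα.1 T w₀ ∈ FracSpace α p T :=
    (Submodule.isClosed_topologicalClosure _).mem_of_tendsto hpot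
      (Eventually.of_forall fun n => (v n).2)
  have hvu : Tendsto v atTop (𝓝 ⟨potential hα.1 T w₀, hmem⟩) := tendsto_subtype_rng.2 hpot
  refine ⟨⟨potential hα.1 T w₀, hmem⟩, fun z => ?_⟩
  have := tendsto_nhds_unique
    (((differentiable_energy hT hα hf).continuous.tendsto _).comp hvu) hvlim
  rw [this]
  exact hmle z

/-- Small multiples of a bump supported where `F(t, x) ≥ η |x|^r` have negative energy: the
exponent `r` is smaller than `p`. -/
lemma exists_energy_neg (hT : 0 < T) (hα : α ∈ Ioc (1 / p) 1)
    (hf : ContinuousOn (Function.uncurry f) (Icc (0 : ℝ) T ×ˢ univ)) {c d η δ r : ℝ}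
    (hc : 0 ≤ c) (hcd : c < d) (hd : d ≤ T) (hη : 0 < η) (hδ : 0 < δ) (hr : 1 < r) (hrp : r < p)
    (hF : ∀ t ∈ Ioo c d, ∀ x ∈ Icc (-δ) δ, η * |x| ^ r ≤ primitive f t x) :
    ∃ u : FracSpace α p T, energy f u < 0 := by
  have hp0 : 0 < p := one_pos.trans hp.out
  have hr0 : 0 < r := by linarith
  obtain ⟨φ, hφs, hφc, hφd, hφr, hφ1⟩ := exists_contDiff_tsupport_subset (n := ⊤)
    (Ioo_mem_nhds (show c < (c + d) / 2 by linarith) (show (c + d) / 2 < d by linarith))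
  have hφ : φ ∈ testFunctions T := ⟨hφd, hφc, hφs.trans (Ioo_subset_Ioo hc hd)⟩
  let u₁ : FracSpace α p T := ⟨graphMap α p T ⟨φ, hφ⟩,
    Submodule.le_topologicalClosure _ (LinearMap.mem_range_self _ _)⟩
  have hu₁ : embed hα.1 T u₁ =ᵐ[volume.restrict (Icc 0 T)] φ :=
    (toLpT_ae_eq_embed hα u₁).symm.trans
      (memLp_of_continuous (ENNReal.ofReal p) T hφ.1.continuous).coeFn_toLp
  have hφ0 : ∀ t, t ∉ Ioo c d → φ t = 0 := fun t ht => by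
    by_contra h
    exact ht (hφs (subset_tsupport φ h))
  have hQc : Continuous fun t => |φ t| ^ r :=
    hφ.1.continuous.abs.rpow_const fun _ => Or.inr hr0.le
  set Q := ∫ t in Icc 0 T, |φ t| ^ r with hQ
  have hQ0 : 0 < Q := by
    rw [hQ, setIntegral_eq_integral_of_forall_compl_eq_zero fun t ht => by
      rw [hφ0 t fun h => ht ⟨hc.trans h.1.le, h.2.le.trans hd⟩, abs_zero, Real.zero_rpow hr0.ne']]
    refine hQc.integral_pos_of_hasCompactSupport_nonneg_nonzero (x := (c + d) / 2) ?_
      (fun t => by positivity) ?_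
    · exact hφc.comp_left (g := fun x : ℝ => |x| ^ r) (by
        rw [abs_zero, Real.zero_rpow hr0.ne'])
    · simp [hφ1]
  set A := 1 / p * ‖(u₁ : LpPair p T).snd‖ ^ p with hA
  have hlim : Tendsto (fun s : ℝ => s ^ (p - r) * A) (𝓝[>] 0) (𝓝 0) := by
    have hcont : Continuous fun s : ℝ => s ^ (p - r) * A :=
      (Real.continuous_rpow_const (by linarith)).mul continuous_const
    have := hcont.tendsto 0
    rw [Real.zero_rpow (sub_pos.2 hrp).ne', zero_mul] at this
    exact this.mono_left nhdsWithin_le_nhds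
  obtain ⟨s, ⟨hs1, hs2⟩, hs0⟩ := ((hlim.eventually_lt_const (mul_pos hη hQ0)).and
    (nhdsWithin_le_nhds (Iio_mem_nhds hδ))).and self_mem_nhdsWithin |>.exists
  have hs0' : 0 < s := hs0
  have hs2' : s < δ := hs2
  refine ⟨s • u₁, ?_⟩
  rw [energy_eq hT hα hf]
  have e1 : ((s • u₁ : FracSpace α p T) : LpPair p T).snd = s • (u₁ : LpPair p T).snd := rfl
  have e2 : η * s ^ r * Q ≤ primitiveInt (stripExtend T f) T (embed hα.1 T (s • u₁)) := by
    rw [primitiveInt, hQ, ← integral_const_mul]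
    refine integral_mono_ae (hQc.continuousOn.integrableOn_Icc.const_mul _)
      (integrableOn_primitive_comp (continuous_stripExtend hT hf) T _) ?_
    filter_upwards [hu₁, ae_restrict_mem measurableSet_Icc] with t h1 ht
    have h3 : embed hα.1 T (s • u₁) t = s * φ t := by
      rw [← h1, map_smul]
      rfl
    rw [h3, primitive_stripExtend ht]
    by_cases htc : t ∈ Ioo c d
    · have hr01 := hφr (mem_range_self t)
      have h2 := hF t htc (s * φ t) ⟨by nlinarith [hr01.1], by nlinarith [hr01.1, hr01.2]⟩
      rwa [abs_mul, Real.mul_rpow (abs_nonneg _) (abs_nonneg _), abs_of_pos hs0', ← mul_assoc] at h2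
    · simp [hφ0 t htc, primitive, Real.zero_rpow hr0.ne']
  have e3 : s ^ p = s ^ r * s ^ (p - r) := by
    rw [← Real.rpow_add hs0']
    congr 1
    ring
  have e4 : 1 / p * ‖s • (u₁ : LpPair p T).snd‖ ^ p = s ^ r * (s ^ (p - r) * A) := by
    rw [norm_smul, Real.mul_rpow (norm_nonneg _) (norm_nonneg _), Real.norm_of_nonneg hs0'.le, e3]
    ring
  rw [e1, e4]
  have e5 := mul_lt_mul_of_pos_left hs1 (Real.rpow_pos_of_pos hs0' r)
  linarith

lemma toLpT_ne_zero_of_energy_neg (hT : 0 < T) (hα : α ∈ Ioc (1 / p) 1)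
    (hf : ContinuousOn (Function.uncurry f) (Icc (0 : ℝ) T ×ˢ univ)) {u : FracSpace α p T}
    (hu : energy f u < 0) : toLpT u ≠ 0 := by
  intro h0
  have hp0 : 0 < p := one_pos.trans hp.out
  have h1 : primitiveInt (stripExtend T f) T (embed hα.1 T u) = 0 := by
    refine integral_eq_zero_of_ae ?_
    have h2 : toLpT u =ᵐ[volume.restrict (Icc 0 T)] (0 : ℝ → ℝ) := by
      rw [h0]
      exact Lp.coeFn_zero _ _ _
    filter_upwards [toLpT_ae_eq_embed hα u, h2] with t h3 h4
    rw [← h3, h4]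
    simp [primitive]
  rw [energy_eq hT hα hf, h1, sub_zero] at hu
  exact absurd hu (not_lt.2 (by positivity))

end Energy

end FracDirichlet

end

theorem theorem1p1 (p α T : ℝ) [Fact (1 < p)] (hα : α ∈ Set.Ioc (1 / p) 1) (hT : 0 < T)
    (f : ℝ → ℝ → ℝ)
    (hf : ContinuousOn (Function.uncurry f) (Set.Icc (0 : ℝ) T ×ˢ Set.univ))
    (H1 : ∃ r₁ : ℝ, 1 < r₁ ∧ r₁ < p ∧ ∃ a : ℝ → ℝ,
      IntegrableOn a (Set.Icc (0 : ℝ) T) ∧ (∀ t ∈ Set.Icc (0 : ℝ) T, 0 ≤ a t) ∧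
      ∀ t ∈ Set.Icc (0 : ℝ) T, ∀ x : ℝ, |f t x| ≤ r₁ * a t * |x| ^ (r₁ - 1))
    (H2 : ∃ c d η δ r₂ : ℝ, 0 ≤ c ∧ c < d ∧ d ≤ T ∧ 0 < η ∧ 0 < δ ∧ 1 < r₂ ∧ r₂ < p ∧
      ∀ t ∈ Set.Ioo c d, ∀ x ∈ Set.Icc (-δ) δ, η * |x| ^ r₂ ≤ FracDirichlet.primitive f t x) :
    (∀ u : FracDirichlet.FracSpace α p T,
      IntegrableOn (FracDirichlet.energyDensity f u) (Set.Icc (0 : ℝ) T)) ∧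
    Tendsto (fun u : FracDirichlet.FracSpace α p T => FracDirichlet.energy f u)
      (Bornology.cobounded (FracDirichlet.FracSpace α p T)) atTop ∧
    ∃ u : FracDirichlet.FracSpace α p T,
      FracDirichlet.toLpT u ≠ 0 ∧
      FracDirichlet.IsWeakSolution f u ∧
      (∀ v : FracDirichlet.FracSpace α p T,
        FracDirichlet.energy f u ≤ FracDirichlet.energy f v) ∧
      FracDirichlet.energy f u < 0 := by
  open FracDirichlet in
  obtain ⟨r₁, hr₁, hr₁p, a, ha, ha0, hb⟩ := H1
  obtain ⟨c, d, η, δ, r₂, hc, hcd, hd, hη, hδ, hr₂, hr₂p, hF⟩ := H2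
  have hp0 : 0 < p := one_pos.trans Fact.out
  obtain ⟨B, hB, hle⟩ := exists_le_energy hT hα hf hr₁ ha ha0 hb
  have hcoer : Tendsto (fun u : FracSpace α p T => energy f u)
      (Bornology.cobounded (FracSpace α p T)) atTop :=
    tendsto_atTop_mono hle ((tendsto_rpow_sub_rpow (by linarith) hr₁p hp0 B).comp
      (tendsto_norm_snd_cobounded hα))
  have hbdd : BddBelow (range (energy f : FracSpace α p T → ℝ)) := by
    obtain ⟨x₀, hx₀⟩ := eventually_atTop.1
      ((tendsto_rpow_sub_rpow (by linarith) hr₁p hp0 B).eventually_ge_atTop 0)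
    have hM : 0 ≤ B * |x₀| ^ r₁ := by positivity
    refine ⟨-(B * |x₀| ^ r₁), ?_⟩
    rintro _ ⟨u, rfl⟩
    refine le_trans ?_ (hle u)
    rcases le_total x₀ ‖(u : LpPair p T).snd‖ with h | h
    · linarith [hx₀ _ h]
    · have h1 : B * ‖(u : LpPair p T).snd‖ ^ r₁ ≤ B * |x₀| ^ r₁ :=
        mul_le_mul_of_nonneg_left (Real.rpow_le_rpow (norm_nonneg _)
          (h.trans (le_abs_self _)) (by linarith)) hB
      have h2 : 0 ≤ 1 / p * ‖(u : LpPair p T).snd‖ ^ p := by positivity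
      linarith
  obtain ⟨u, hu⟩ := exists_forall_energy_le hT hα hf hbdd hcoer
  obtain ⟨v, hv⟩ := exists_energy_neg hT hα hf hc hcd hd hη hδ hr₂ hr₂p hF
  have hneg : energy f u < 0 := (hu v).trans_lt hv
  refine ⟨integrableOn_energyDensity hT hα hf, hcoer, u,
    toLpT_ne_zero_of_energy_neg hT hα hf hneg, ?_, hu, hneg⟩
  have hd := (differentiable_energy hT hα hf u).hasFDerivAt
  have hmin : IsLocalMin (energy f : FracSpace α p T → ℝ) u := Eventually.of_forall hu
  rw [hmin.hasFDerivAt_eq_zero hd] at hd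
  exact hd
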